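/- Let $\alpha,p\in(0,1)$ be fixed, put $q=1-p$, and let $z=z_{\alpha/2}$ be the upper $\alpha/2$ quantile of the standard normal distribution, i.e. $\Phi(z)=1-\alpha/2$. For $n\ge 1$ and $X\in\{0,1,\dots,n\}$ the two-sided $1-\alpha$ Clopper--Pearson interval has end points $p_L,p_U\in[0,1]$ defined by $$\sum_{k=X}^n\binom nk p_L^k(1-p_L)^{n-k}=\frac{\alpha}{2}\quad(X\ge 1),\qquad \sum_{k=0}^X\binom nk p_U^k(1-p_U)^{n-k}=\frac{\alpha}{2}\quad(X\le n-1),$$ with $p_L=0$ if $X=0$ and $p_U=1$ if $X=n$. Let $L_{CP}=p_U-p_L$ be its length, and let $X\sim\mathrm{Bin}(n,p)$. Then, as $n\to\infty$, $$E(L_{CP})=2z\,n^{-1/2}(pq)^{1/2}+n^{-1}+n^{-3/2}(pq)^{-1/2}\,\frac{z}{18}\Big(z^2-\frac52-17pq-13pq\,z^2\Big)+O(n^{-2}),$$ where the implied constant may depend on $\alpha$ and $p$. -/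

import Mathlib

/-- `P(Bin(n, θ) ≥ x)`, written as the explicit sum. -/
noncomputable def binomialUpperTail (n x : ℕ) (θ : ℝ) : ℝ :=
  ∑ k ∈ Finset.Icc x n, (n.choose k : ℝ) * θ ^ k * (1 - θ) ^ (n - k)

/-- `P(Bin(n, θ) ≤ x)`, written as the explicit sum (over `0 ≤ k ≤ x`). -/
noncomputable def binomialLowerTail (n x : ℕ) (θ : ℝ) : ℝ :=
  ∑ k ∈ Finset.range (x + 1), (n.choose k : ℝ) * θ ^ k * (1 - θ) ^ (n - k)

/-- Lower end point of the two-sided `1 - α` Clopper–Pearson interval for the observation `x`: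
`0` if `x = 0`, and otherwise the unique `θ ∈ [0, 1]` with `P(Bin(n, θ) ≥ x) = α / 2`
(the set below is a singleton, see `existsUnique_binomialUpperTail_eq`). -/
noncomputable def clopperPearsonLower (n : ℕ) (α : ℝ) (x : ℕ) : ℝ :=
  if x = 0 then 0 else sInf {θ : ℝ | θ ∈ Set.Icc 0 1 ∧ binomialUpperTail n x θ = α / 2}

/-- Upper end point of the two-sided `1 - α` Clopper–Pearson interval for the observation `x`:
`1` if `x = n`, and otherwise the unique `θ ∈ [0, 1]` with `P(Bin(n, θ) ≤ x) = α / 2`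
(the set below is a singleton, see `existsUnique_binomialLowerTail_eq`). -/
noncomputable def clopperPearsonUpper (n : ℕ) (α : ℝ) (x : ℕ) : ℝ :=
  if x = n then 1 else sInf {θ : ℝ | θ ∈ Set.Icc 0 1 ∧ binomialLowerTail n x θ = α / 2}

/-- Length of the two-sided `1 - α` Clopper–Pearson interval for the observation `x`. -/
noncomputable def clopperPearsonLength (n : ℕ) (α : ℝ) (x : ℕ) : ℝ :=
  clopperPearsonUpper n α x - clopperPearsonLower n α x

/-- Expectation of the length of the Clopper–Pearson interval when `X ~ Bin(n, p)`. -/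
noncomputable def expectedClopperPearsonLength (n : ℕ) (α : ℝ) (p : unitInterval) : ℝ :=
  ∫ x, clopperPearsonLength n α x ∂(ProbabilityTheory.binomial n p)

/-- The upper `β` quantile of the standard normal distribution,
i.e. its `(1 - β)`-quantile `inf {x | Φ(x) ≥ 1 - β}`. -/
noncomputable def stdNormalUpperQuantile (β : ℝ) : ℝ :=
  sInf {x : ℝ | 1 - β ≤ ProbabilityTheory.cdf (ProbabilityTheory.gaussianReal 0 1) x}

lemma binomialUpperTail_continuous (n x : ℕ) : Continuous (binomialUpperTail n x) := by
  unfold binomialUpperTail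
  fun_prop

lemma binomialUpperTail_hasDerivAt (n x : ℕ) (hx : x ≤ n) (θ : ℝ) :
    HasDerivAt (binomialUpperTail (n + 1) (x + 1))
      (((n : ℝ) + 1) * ((n.choose x : ℝ) * θ ^ x * (1 - θ) ^ (n - x))) θ := by
  have hB : ∀ m k : ℕ, (bernsteinPolynomial ℝ m k).eval θ
      = (m.choose k : ℝ) * θ ^ k * (1 - θ) ^ (m - k) := by
    intro m k
    simp [bernsteinPolynomial]
  have hf : binomialUpperTail (n + 1) (x + 1) = fun t =>
      (∑ k ∈ Finset.Ico x (n + 1), bernsteinPolynomial ℝ (n + 1) (k + 1)).eval t := by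
    funext t
    rw [Polynomial.eval_finsetSum, binomialUpperTail, ← Finset.Ico_add_one_right_eq_Icc,
      ← Finset.sum_Ico_add']
    simp [bernsteinPolynomial]
  rw [hf]
  refine (Polynomial.hasDerivAt _ θ).congr_deriv ?_
  rw [Polynomial.derivative_sum]
  simp only [bernsteinPolynomial.derivative_succ_aux]
  rw [← Finset.mul_sum, Polynomial.eval_mul, ← hB]
  have ht : ∑ k ∈ Finset.Ico x (n + 1),
      (bernsteinPolynomial ℝ n k - bernsteinPolynomial ℝ n (k + 1))
      = bernsteinPolynomial ℝ n x - bernsteinPolynomial ℝ n (n + 1) := by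
    have h := Finset.sum_Ico_sub (fun k => bernsteinPolynomial ℝ n k)
      (show x ≤ n + 1 by omega)
    rw [← neg_sub (bernsteinPolynomial ℝ n (n + 1)), ← h, ← Finset.sum_neg_distrib]
    simp
  rw [ht, bernsteinPolynomial.eq_zero_of_lt ℝ (Nat.lt_succ_self n)]
  simp

lemma binomialUpperTail_strictMonoOn (n x : ℕ) (hx0 : x ≠ 0) (hxn : x ≤ n) :
    StrictMonoOn (binomialUpperTail n x) (Set.Icc 0 1) := by
  obtain ⟨y, rfl⟩ := Nat.exists_eq_succ_of_ne_zero hx0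
  obtain ⟨m, rfl⟩ : ∃ m, n = m + 1 := ⟨n - 1, by omega⟩
  refine strictMonoOn_of_deriv_pos (convex_Icc 0 1)
    (binomialUpperTail_continuous _ _).continuousOn ?_
  intro θ hθ
  rw [interior_Icc] at hθ
  have hy : y ≤ m := by omega
  rw [Nat.succ_eq_add_one, (binomialUpperTail_hasDerivAt m y hy θ).deriv]
  have h1 : 0 < 1 - θ := by linarith [hθ.2]
  have h0 : 0 < θ := hθ.1
  have hc : (0 : ℝ) < m.choose y := by exact_mod_cast Nat.choose_pos hy
  positivity

lemma binomialUpperTail_zero (n x : ℕ) (hx0 : x ≠ 0) : binomialUpperTail n x 0 = 0 := by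
  refine Finset.sum_eq_zero fun k hk => ?_
  have : k ≠ 0 := by have := (Finset.mem_Icc.mp hk).1; omega
  simp [this]

lemma binomialUpperTail_one (n x : ℕ) (hxn : x ≤ n) : binomialUpperTail n x 1 = 1 := by
  rw [binomialUpperTail, Finset.sum_eq_single n]
  · simp
  · intro k hk hkn
    have : n - k ≠ 0 := by have := (Finset.mem_Icc.mp hk).2; omega
    simp [this]
  · intro h
    exact absurd (Finset.mem_Icc.mpr ⟨hxn, le_rfl⟩) h

lemma existsUnique_binomialUpperTail_eq (n x : ℕ) (hx0 : x ≠ 0) (hxn : x ≤ n) (c : ℝ)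
    (hc : c ∈ Set.Icc (0 : ℝ) 1) :
    ∃! θ : ℝ, θ ∈ Set.Icc (0 : ℝ) 1 ∧ binomialUpperTail n x θ = c := by
  have h := intermediate_value_Icc (zero_le_one' ℝ)
    (binomialUpperTail_continuous n x).continuousOn
  rw [binomialUpperTail_zero n x hx0, binomialUpperTail_one n x hxn] at h
  obtain ⟨θ, hθ, he⟩ := h hc
  refine ⟨θ, ⟨hθ, he⟩, fun t ht => ?_⟩
  exact (binomialUpperTail_strictMonoOn n x hx0 hxn).injOn ht.1 hθ (ht.2.trans he.symm)

lemma binomialLowerTail_eq (n x : ℕ) (hxn : x < n) (θ : ℝ) :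
    binomialLowerTail n x θ = 1 - binomialUpperTail n (x + 1) θ := by
  have h : ∑ k ∈ Finset.range (n + 1), (n.choose k : ℝ) * θ ^ k * (1 - θ) ^ (n - k) = 1 := by
    have := add_pow θ (1 - θ) n
    rw [add_sub_cancel, one_pow] at this
    refine Eq.trans ?_ this.symm
    exact Finset.sum_congr rfl fun k _ => by ring
  rw [← Finset.sum_range_add_sum_Ico _ (show x + 1 ≤ n + 1 by omega)] at h
  rw [binomialLowerTail, binomialUpperTail, ← Finset.Ico_add_one_right_eq_Icc]
  linarith

lemma existsUnique_binomialLowerTail_eq (n x : ℕ) (hxn : x < n) (c : ℝ)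
    (hc : c ∈ Set.Icc (0 : ℝ) 1) :
    ∃! θ : ℝ, θ ∈ Set.Icc (0 : ℝ) 1 ∧ binomialLowerTail n x θ = c := by
  obtain ⟨θ, ⟨hθ, he⟩, hu⟩ := existsUnique_binomialUpperTail_eq n (x + 1) (by omega)
    (by omega) (1 - c) ⟨by linarith [hc.2], by linarith [hc.1]⟩
  refine ⟨θ, ⟨hθ, by rw [binomialLowerTail_eq n x hxn]; linarith⟩, fun t ht => hu t ⟨ht.1, ?_⟩⟩
  have := ht.2
  rw [binomialLowerTail_eq n x hxn] at this
  linarith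

lemma clopperPearsonLower_spec (n x : ℕ) (hx0 : x ≠ 0) (hxn : x ≤ n) (α : ℝ)
    (hα : α ∈ Set.Ioo (0 : ℝ) 1) :
    clopperPearsonLower n α x ∈ Set.Icc (0 : ℝ) 1 ∧
      binomialUpperTail n x (clopperPearsonLower n α x) = α / 2 := by
  obtain ⟨θ, hθ, hu⟩ := existsUnique_binomialUpperTail_eq n x hx0 hxn (α / 2)
    ⟨by linarith [hα.1], by linarith [hα.2]⟩
  have hs : {θ : ℝ | θ ∈ Set.Icc 0 1 ∧ binomialUpperTail n x θ = α / 2} = {θ} :=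
    Set.eq_singleton_iff_unique_mem.mpr ⟨hθ, fun t ht => hu t ht⟩
  rw [clopperPearsonLower, if_neg hx0, hs, csInf_singleton]
  exact hθ

lemma clopperPearsonUpper_spec (n x : ℕ) (hxn : x < n) (α : ℝ)
    (hα : α ∈ Set.Ioo (0 : ℝ) 1) :
    clopperPearsonUpper n α x ∈ Set.Icc (0 : ℝ) 1 ∧
      binomialLowerTail n x (clopperPearsonUpper n α x) = α / 2 := by
  obtain ⟨θ, hθ, hu⟩ := existsUnique_binomialLowerTail_eq n x hxn (α / 2)
    ⟨by linarith [hα.1], by linarith [hα.2]⟩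
  have hs : {θ : ℝ | θ ∈ Set.Icc 0 1 ∧ binomialLowerTail n x θ = α / 2} = {θ} :=
    Set.eq_singleton_iff_unique_mem.mpr ⟨hθ, fun t ht => hu t ht⟩
  rw [clopperPearsonUpper, if_neg hxn.ne, hs, csInf_singleton]
  exact hθ

/-!
Let `ε = n ^ (-1/2)` and `r = X / n`. The lower end point is the quantile of order `α / 2` of a beta
distribution. Substituting the Cornish–Fisher approximation `T u` of the beta quantile of order
`Φ u` into the beta density turns it into `K` times the normal density up to a relative error
`O(ε ^ 3)`: the logarithmic derivative of the ratio has vanishing coefficients at `1`, `ε` and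
`ε ^ 2`. On the window `|u| ≤ -2 log ε` this holds uniformly for `r` away from `0` and `1`, while
outside it both distributions have mass at most `ε ^ 3`. Comparing total masses gives
`K = 1 + O(ε ^ 3)`, and inverting the distribution function puts the end point at
`T (-z) + O(ε ^ 4)`.

By the symmetry `p_U(X) = 1 - p_L(n - X)`, the length is
`2 z ε σ(r) + ε ^ 2 + ε ^ 3 c(r) + O(ε ^ 4)` with `σ(r) ^ 2 = r (1 - r)`. Taylor expansion at
`r = p` and integration against the binomial distribution leave one correction,
`-z ε ^ 3 / (4 σ(p))`, from the variance of `r` and the second derivative of `σ`.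
-/

open Filter MeasureTheory ProbabilityTheory Set
open scoped Topology

section Normal

lemma hasDerivAt_integral_Iic {E : Type*} [NormedAddCommGroup E] [NormedSpace ℝ E]
    [CompleteSpace E] {f : ℝ → E} (hf : Integrable f) (hc : Continuous f) (x : ℝ) :
    HasDerivAt (fun u => ∫ t in Iic u, f t) (f x) x := by
  have h : (fun u => ∫ t in Iic u, f t)
      = fun u => (∫ t in Iic 0, f t) + ∫ t in (0 : ℝ)..u, f t := by
    funext u
    rw [← intervalIntegral.integral_Iic_sub_Iic hf.integrableOn hf.integrableOn]
    abel
  rw [h]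
  exact (hc.integral_hasStrictDerivAt 0 x).hasDerivAt.const_add _

lemma integrable_gaussianPDFReal_mul_one_add_abs_pow (μ : ℝ) (v : NNReal) (k : ℕ) :
    Integrable fun t => gaussianPDFReal μ v t * (1 + |t|) ^ k := by
  rcases eq_or_ne v 0 with rfl | hv
  · simp
  have hLp : MemLp (fun t : ℝ => 1 + |t|) k (gaussianReal μ v) :=
    (memLp_const (1 : ℝ)).add (memLp_id_gaussianReal' k (ENNReal.natCast_ne_top k)).norm
  have h : Integrable (fun t : ℝ => ‖1 + |t|‖ ^ k) (gaussianReal μ v) := hLp.integrable_norm_pow'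
  rw [gaussianReal_of_var_ne_zero μ hv, integrable_withDensity_iff (measurable_gaussianPDF μ v)
    (ae_of_all _ fun _ => gaussianPDF_lt_top)] at h
  refine h.congr (ae_of_all _ fun t => ?_)
  beta_reduce
  rw [toReal_gaussianPDF, Real.norm_of_nonneg (by positivity), mul_comm]

lemma continuous_gaussianPDFReal (μ : ℝ) (v : NNReal) : Continuous (gaussianPDFReal μ v) := by
  unfold gaussianPDFReal
  fun_prop

lemma gaussianPDFReal_zero_neg (v : NNReal) (x : ℝ) :
    gaussianPDFReal 0 v (-x) = gaussianPDFReal 0 v x := by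
  simp [gaussianPDFReal]

lemma cdf_gaussianReal_eq_integral (μ : ℝ) {v : NNReal} (hv : v ≠ 0) (x : ℝ) :
    cdf (gaussianReal μ v) x = ∫ t in Iic x, gaussianPDFReal μ v t := by
  rw [cdf_eq_real, measureReal_def, gaussianReal_apply_eq_integral μ hv,
    ENNReal.toReal_ofReal (integral_nonneg fun _ => gaussianPDFReal_nonneg _ _ _)]

lemma hasDerivAt_cdf_gaussianReal (μ : ℝ) {v : NNReal} (hv : v ≠ 0) (x : ℝ) :
    HasDerivAt (cdf (gaussianReal μ v)) (gaussianPDFReal μ v x) x := by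
  rw [funext (cdf_gaussianReal_eq_integral μ hv)]
  exact hasDerivAt_integral_Iic (integrable_gaussianPDFReal μ v) (continuous_gaussianPDFReal μ v) x

lemma strictMono_cdf_gaussianReal (μ : ℝ) {v : NNReal} (hv : v ≠ 0) :
    StrictMono (cdf (gaussianReal μ v)) :=
  strictMono_of_hasDerivAt_pos (hasDerivAt_cdf_gaussianReal μ hv)
    fun x => gaussianPDFReal_pos μ v x hv

lemma continuous_cdf_gaussianReal (μ : ℝ) {v : NNReal} (hv : v ≠ 0) :
    Continuous (cdf (gaussianReal μ v)) :=
  continuous_iff_continuousAt.2 fun x => (hasDerivAt_cdf_gaussianReal μ hv x).continuousAt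

lemma cdf_gaussianReal_zero_neg {v : NNReal} (hv : v ≠ 0) (x : ℝ) :
    cdf (gaussianReal 0 v) (-x) = 1 - cdf (gaussianReal 0 v) x := by
  have hint {s : Set ℝ} : IntegrableOn (gaussianPDFReal 0 v) s :=
    (integrable_gaussianPDFReal 0 v).integrableOn
  have hneg : ∫ t in Iic (-x), gaussianPDFReal 0 v t = ∫ t in Ioi x, gaussianPDFReal 0 v t := by
    simp only [← integral_comp_neg_Ioi, gaussianPDFReal_zero_neg]
  rw [cdf_gaussianReal_eq_integral 0 hv, cdf_gaussianReal_eq_integral 0 hv, hneg,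
    ← integral_gaussianPDFReal_eq_one 0 hv, ← intervalIntegral.integral_Iic_add_Ioi hint hint]
  ring

lemma cdf_stdNormal_neg_le {M : ℝ} (hM : 0 ≤ M) :
    cdf (gaussianReal 0 1) (-M) ≤ Real.exp (-(M ^ 2 / 2)) := by
  have h := measure_le_le_exp_mul_mgf (μ := gaussianReal 0 1) (X := id) (t := -M) (-M)
    (neg_nonpos.2 hM) (by simpa using integrable_exp_mul_gaussianReal (-M))
  rw [mgf_id_gaussianReal, ← Real.exp_add] at h
  rw [cdf_eq_real]
  refine h.trans_eq (congrArg Real.exp ?_)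
  norm_num
  ring

lemma exists_cdf_eq {μ : Measure ℝ} (hμ : Continuous (cdf μ)) {c : ℝ} (hc : c ∈ Ioo (0 : ℝ) 1) :
    ∃ x, cdf μ x = c := by
  obtain ⟨x, hx⟩ := ((tendsto_cdf_atBot μ).eventually_lt_const hc.1).exists
  obtain ⟨y, hy⟩ := ((tendsto_cdf_atTop μ).eventually_const_lt hc.2).exists
  exact mem_range_of_exists_le_of_exists_ge hμ ⟨x, hx.le⟩ ⟨y, hy.le⟩

lemma cdf_neg_stdNormalUpperQuantile {β : ℝ} (hβ : β ∈ Ioo (0 : ℝ) 1) :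
    cdf (gaussianReal 0 1) (-stdNormalUpperQuantile β) = β := by
  obtain ⟨x, hx⟩ := exists_cdf_eq (continuous_cdf_gaussianReal 0 one_ne_zero)
    (c := 1 - β) ⟨by linarith [hβ.2], by linarith [hβ.1]⟩
  have hset : {y : ℝ | 1 - β ≤ cdf (gaussianReal 0 1) y} = Ici x := by
    ext y
    rw [mem_ofPred_eq, ← hx, (strictMono_cdf_gaussianReal 0 one_ne_zero).le_iff_le, mem_Ici]
  rw [stdNormalUpperQuantile, hset, csInf_Ici, cdf_gaussianReal_zero_neg one_ne_zero, hx]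
  ring

lemma gaussianPDFReal_zero_anti {v : NNReal} {x y : ℝ} (h : |x| ≤ |y|) :
    gaussianPDFReal 0 v y ≤ gaussianPDFReal 0 v x := by
  have hsq : x ^ 2 ≤ y ^ 2 := sq_le_sq.2 h
  unfold gaussianPDFReal
  simp only [sub_zero]
  gcongr

lemma gaussianPDFReal_mul_sub_le_cdf_sub {v : NNReal} (hv : v ≠ 0) {B s t : ℝ} (hst : s ≤ t)
    (hs : -B ≤ s) (ht : t ≤ B) :
    gaussianPDFReal 0 v B * (t - s) ≤ cdf (gaussianReal 0 v) t - cdf (gaussianReal 0 v) s := by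
  refine Convex.mul_sub_le_image_sub_of_le_deriv (convex_Icc s t)
    (continuous_cdf_gaussianReal 0 hv).continuousOn
    (fun u _ => (hasDerivAt_cdf_gaussianReal 0 hv u).differentiableAt.differentiableWithinAt)
    (fun u hu => ?_) s (left_mem_Icc.2 hst) t (right_mem_Icc.2 hst) hst
  rw [interior_Icc] at hu
  rw [(hasDerivAt_cdf_gaussianReal 0 hv u).deriv]
  exact gaussianPDFReal_zero_anti
    ((abs_le.2 ⟨by linarith [hu.1], by linarith [hu.2]⟩).trans (le_abs_self B))

end Normal

section Comparison

lemma abs_sub_le_integral_of_abs_deriv_le {S s g : ℝ → ℝ} {a b : ℝ} (hab : a ≤ b)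
    (hg : Integrable g) (hgc : Continuous g) (hg0 : 0 ≤ g)
    (hS : ∀ t ∈ Icc a b, HasDerivAt S (s t) t) (hs : ∀ t ∈ Icc a b, |s t| ≤ g t) :
    |S b - S a| ≤ ∫ t, g t := by
  have hbound := image_norm_le_of_norm_deriv_right_le_deriv_boundary
    (f := fun t => S t - S a) (f' := s) (B := fun t => ∫ w in Iic t, g w) (B' := g)
    (fun t ht => ((hS t ht).sub_const _).continuousAt.continuousWithinAt)
    (fun t ht => ((hS t (Ico_subset_Icc_self ht)).sub_const _).hasDerivWithinAt)
    (by simpa using setIntegral_nonneg measurableSet_Iic fun t _ => hg0 t)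
    (hasDerivAt_integral_Iic hg hgc) (fun t ht => hs t (Ico_subset_Icc_self ht))
    (right_mem_Icc.2 hab)
  exact hbound.trans (setIntegral_le_integral hg (ae_of_all _ hg0))

-- `F` is a distribution function close to an unknown multiple `K` of the distribution function `G`;
-- `FM`, `GM` and `A`, `B` are the values of `F`, `G` at the right and left ends of the window.
-- The comparison at the right end forces `K` to be close to `1`.
lemma abs_sub_le_of_abs_sub_mul_le {F G K τ η A B FM GM : ℝ} (hF : F ∈ Icc (0 : ℝ) 1)
    (hG : G ∈ Icc (0 : ℝ) 1) (hK : 0 < K) (hη : 0 ≤ η) (hA : A ∈ Icc 0 τ) (hB : B ∈ Icc 0 τ)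
    (hFM : FM ∈ Icc (1 - τ) 1) (hGM : GM ∈ Icc (1 - τ) 1)
    (hM : |FM - K * GM - (A - K * B)| ≤ K * η) (h : |F - K * G - (A - K * B)| ≤ K * η) :
    |F - G| ≤ 6 * (τ + η) := by
  obtain ⟨hF0, hF1⟩ := hF
  obtain ⟨hG0, hG1⟩ := hG
  obtain ⟨hA0, hA1⟩ := hA
  obtain ⟨hB0, hB1⟩ := hB
  rcases le_total (1 / 6) (τ + η) with hlarge | hsmall
  · rw [abs_le]
    constructor <;> linarith
  obtain ⟨hMl, hMu⟩ := abs_le.1 hM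
  obtain ⟨hl, hu⟩ := abs_le.1 h
  have hK2 : K ≤ 3 / 2 := by nlinarith [hFM.2, hGM.1]
  have hKτ : K * τ ≤ 3 / 2 * τ := mul_le_mul_of_nonneg_right hK2 (by linarith)
  have hKη : K * η ≤ 3 / 2 * η := mul_le_mul_of_nonneg_right hK2 hη
  have hKB : K * B ≤ K * τ := mul_le_mul_of_nonneg_left hB1 hK.le
  have hKB0 : 0 ≤ K * B := by positivity
  have hKGM : K * (1 - τ) ≤ K * GM := mul_le_mul_of_nonneg_left hGM.1 hK.le
  have hKGM1 : K * GM ≤ K * 1 := mul_le_mul_of_nonneg_left hGM.2 hK.le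
  have hK1 : |K - 1| ≤ 3 * τ + 3 / 2 * η := by
    rw [abs_le]
    constructor <;> linarith [hFM.1, hFM.2]
  have hKG : |(K - 1) * G| ≤ 3 * τ + 3 / 2 * η := by
    rw [abs_mul, abs_of_nonneg hG0]
    exact (mul_le_of_le_one_right (abs_nonneg _) hG1).trans hK1
  obtain ⟨hKGl, hKGu⟩ := abs_le.1 hKG
  rw [abs_le]
  constructor <;> linarith

lemma abs_sub_cdf_stdNormal_le {F f : ℝ → ℝ} {K M δ τ : ℝ} {j : ℕ} (hK : 0 < K) (hδ : 0 ≤ δ)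
    (hF01 : ∀ u ∈ Icc (-M) M, F u ∈ Icc (0 : ℝ) 1)
    (hF : ∀ u ∈ Icc (-M) M, HasDerivAt F (f u) u)
    (hf : ∀ u ∈ Icc (-M) M, |f u - K * gaussianPDFReal 0 1 u| ≤
      K * gaussianPDFReal 0 1 u * (δ * (1 + |u|) ^ j))
    (hFl : F (-M) ≤ τ) (hFu : 1 - F M ≤ τ) (hτ : cdf (gaussianReal 0 1) (-M) ≤ τ)
    {u : ℝ} (hu : u ∈ Icc (-M) M) :
    |F u - cdf (gaussianReal 0 1) u|
      ≤ 6 * (τ + δ * ∫ t, gaussianPDFReal 0 1 t * (1 + |t|) ^ j) := by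
  have hM : -M ≤ M := hu.1.trans hu.2
  have hφ (t : ℝ) : 0 ≤ gaussianPDFReal 0 1 t := gaussianPDFReal_nonneg 0 1 t
  have hΦ (t : ℝ) : cdf (gaussianReal 0 1) t ∈ Icc (0 : ℝ) 1 := ⟨cdf_nonneg _ t, cdf_le_one _ t⟩
  have key (v : ℝ) (hv : v ∈ Icc (-M) M) :
      |F v - K * cdf (gaussianReal 0 1) v - (F (-M) - K * cdf (gaussianReal 0 1) (-M))|
        ≤ K * (δ * ∫ t, gaussianPDFReal 0 1 t * (1 + |t|) ^ j) := by
    have hsub : Icc (-M) v ⊆ Icc (-M) M := Icc_subset_Icc_right hv.2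
    have hcont := continuous_gaussianPDFReal 0 1
    rw [← integral_const_mul, ← integral_const_mul]
    refine abs_sub_le_integral_of_abs_deriv_le
      (S := fun t => F t - K * cdf (gaussianReal 0 1) t) hv.1
      (((integrable_gaussianPDFReal_mul_one_add_abs_pow 0 1 j).const_mul δ).const_mul K)
      (by fun_prop) (fun t => ?_)
      (fun t ht => (hF t (hsub ht)).sub ((hasDerivAt_cdf_gaussianReal 0 one_ne_zero t).const_mul K))
      fun t ht => (hf t (hsub ht)).trans_eq (by ring)
    have := hφ t
    simp only [Pi.zero_apply]
    positivity
  have hleft := left_mem_Icc.2 hM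
  have hright := right_mem_Icc.2 hM
  have hΦM := cdf_gaussianReal_zero_neg one_ne_zero M
  exact abs_sub_le_of_abs_sub_mul_le (hF01 u hu) (hΦ u) hK
    (mul_nonneg hδ (integral_nonneg fun t => mul_nonneg (hφ t) (by positivity)))
    ⟨(hF01 _ hleft).1, hFl⟩ ⟨(hΦ _).1, hτ⟩
    ⟨by linarith, (hF01 _ hright).2⟩ ⟨by linarith, (hΦ _).2⟩ (key M hright) (key u hu)

end Comparison

section BinomialTail

lemma one_sub_add_mul_exp_le {θ t : ℝ} (hθ : 0 ≤ θ) (ht : |t| ≤ 1) :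
    1 - θ + θ * Real.exp t ≤ Real.exp (θ * (t + t ^ 2)) := by
  have hexp : Real.exp t - 1 - t ≤ t ^ 2 :=
    (le_abs_self _).trans (Real.abs_exp_sub_one_sub_id_le ht)
  calc 1 - θ + θ * Real.exp t ≤ θ * (t + t ^ 2) + 1 := by nlinarith
    _ ≤ Real.exp (θ * (t + t ^ 2)) := Real.add_one_le_exp _

lemma sum_binomial_eq_one (n : ℕ) (θ : ℝ) :
    ∑ k ∈ Finset.range (n + 1), (n.choose k : ℝ) * θ ^ k * (1 - θ) ^ (n - k) = 1 := by
  have h := add_pow θ (1 - θ) n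
  rw [add_sub_cancel, one_pow] at h
  exact (Finset.sum_congr rfl fun k _ => by ring).trans h.symm

lemma binomialUpperTail_mem_Icc (n x : ℕ) {θ : ℝ} (hθ : θ ∈ Icc (0 : ℝ) 1) :
    binomialUpperTail n x θ ∈ Icc (0 : ℝ) 1 := by
  have hθ0 := hθ.1
  have hθ1 : 0 ≤ 1 - θ := sub_nonneg.2 hθ.2
  refine ⟨Finset.sum_nonneg fun k _ => by positivity, ?_⟩
  rw [← sum_binomial_eq_one n θ]
  refine Finset.sum_le_sum_of_subset_of_nonneg (fun k hk => ?_) fun k _ _ => by positivity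
  simp only [Finset.mem_Icc, Finset.mem_range] at hk ⊢
  omega

lemma binomialUpperTail_le_exp_mul_pow (n x : ℕ) {θ t : ℝ} (hθ : θ ∈ Icc (0 : ℝ) 1)
    (ht : 0 ≤ t) :
    binomialUpperTail n x θ ≤ Real.exp (-(x * t)) * (1 - θ + θ * Real.exp t) ^ n := by
  have hθ0 := hθ.1
  have hθ1 : 0 ≤ 1 - θ := sub_nonneg.2 hθ.2
  calc binomialUpperTail n x θ
      ≤ ∑ k ∈ Finset.Icc x n, Real.exp (-(x * t)) *
          ((θ * Real.exp t) ^ k * (1 - θ) ^ (n - k) * n.choose k) := by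
        refine Finset.sum_le_sum fun k hk => ?_
        have hxk : (x : ℝ) ≤ k := mod_cast (Finset.mem_Icc.1 hk).1
        have hone : 1 ≤ Real.exp (-(x * t)) * Real.exp t ^ k := by
          rw [← Real.exp_nat_mul, ← Real.exp_add, Real.one_le_exp_iff]
          nlinarith
        calc (n.choose k : ℝ) * θ ^ k * (1 - θ) ^ (n - k)
            ≤ (n.choose k : ℝ) * θ ^ k * (1 - θ) ^ (n - k) *
                (Real.exp (-(x * t)) * Real.exp t ^ k) :=
              le_mul_of_one_le_right (by positivity) hone
          _ = _ := by rw [mul_pow]; ring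
    _ ≤ ∑ k ∈ Finset.range (n + 1), Real.exp (-(x * t)) *
          ((θ * Real.exp t) ^ k * (1 - θ) ^ (n - k) * n.choose k) := by
        refine Finset.sum_le_sum_of_subset_of_nonneg (fun k hk => ?_) fun k _ _ => by positivity
        simp only [Finset.mem_Icc, Finset.mem_range] at hk ⊢
        omega
    _ = Real.exp (-(x * t)) * (1 - θ + θ * Real.exp t) ^ n := by
        rw [← Finset.mul_sum, ← add_pow, add_comm]

lemma binomialUpperTail_le_exp {n x : ℕ} (hx : x ≤ n) {θ : ℝ} (hθ : θ ∈ Icc (0 : ℝ) 1)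
    (h : n * θ ≤ x) : binomialUpperTail n x θ ≤ Real.exp (-((x - n * θ) ^ 2 / (4 * n))) := by
  rcases n.eq_zero_or_pos with rfl | hn
  · simpa using (binomialUpperTail_mem_Icc 0 x hθ).2
  have hn' : (0 : ℝ) < n := mod_cast hn
  have hxn : (x : ℝ) ≤ n := mod_cast hx
  obtain ⟨t, ht⟩ : ∃ t, t = (x - n * θ) / (2 * n) := ⟨_, rfl⟩
  have ht0 : 0 ≤ t := ht ▸ div_nonneg (sub_nonneg.2 h) (by positivity)
  have ht1 : |t| ≤ 1 := by
    rw [abs_of_nonneg ht0, ht, div_le_one (by positivity)]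
    nlinarith [hθ.1]
  have hδ : x - n * θ = 2 * n * t := by rw [ht]; field_simp
  calc binomialUpperTail n x θ
      ≤ Real.exp (-(x * t)) * (1 - θ + θ * Real.exp t) ^ n :=
        binomialUpperTail_le_exp_mul_pow n x hθ ht0
    _ ≤ Real.exp (-(x * t)) * Real.exp (θ * (t + t ^ 2)) ^ n := by
        gcongr
        · have := hθ.1
          have := hθ.2
          have := Real.exp_pos t
          nlinarith
        · exact one_sub_add_mul_exp_le hθ.1 ht1
    _ = Real.exp (-(x * t) + n * (θ * (t + t ^ 2))) := by
        rw [← Real.exp_nat_mul, ← Real.exp_add]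
    _ ≤ Real.exp (-((x - n * θ) ^ 2 / (4 * n))) := by
        rw [Real.exp_le_exp, hδ]
        have hsq : (2 * n * t) ^ 2 / (4 * n) = n * t ^ 2 := by field_simp; ring
        have hle : n * t ^ 2 * θ ≤ n * t ^ 2 := mul_le_of_le_one_right (by positivity) hθ.2
        nlinarith

lemma binomialLowerTail_one_sub {n x : ℕ} (hx : x ≤ n) (θ : ℝ) :
    binomialLowerTail n x (1 - θ) = binomialUpperTail n (n - x) θ := by
  rw [binomialLowerTail, binomialUpperTail, ← Finset.Ico_add_one_right_eq_Icc,
    Finset.range_eq_Ico]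
  have hreflect := Finset.sum_Ico_reflect
    (fun k => (n.choose k : ℝ) * θ ^ k * (1 - θ) ^ (n - k)) 0 (m := x + 1) (n := n) (by omega)
  rw [show n + 1 - (x + 1) = n - x by omega, Nat.sub_zero] at hreflect
  rw [← hreflect]
  refine Finset.sum_congr rfl fun k hk => ?_
  have hkn : k ≤ n := by have := (Finset.mem_Ico.1 hk).2; omega
  rw [Nat.choose_symm hkn, Nat.sub_sub_self hkn, sub_sub_cancel]
  ring

lemma binomialLowerTail_le_exp {n x : ℕ} (hx : x ≤ n) {θ : ℝ} (hθ : θ ∈ Icc (0 : ℝ) 1)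
    (h : x ≤ n * θ) : binomialLowerTail n x θ ≤ Real.exp (-((n * θ - x) ^ 2 / (4 * n))) := by
  rw [← sub_sub_cancel 1 θ, binomialLowerTail_one_sub hx]
  have hcast : ((n - x : ℕ) : ℝ) = n - x := Nat.cast_sub hx
  refine (binomialUpperTail_le_exp (Nat.sub_le n x)
    ⟨sub_nonneg.2 hθ.2, by linarith [hθ.1]⟩ (by rw [hcast]; linarith)).trans_eq ?_
  rw [hcast]
  ring_nf

end BinomialTail

section Expansion

/-- Polynomial growth in `u`, uniformly for `r ∈ [a, 1 - a]` and `ε ∈ [0, 1]`: the condition on the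
coefficients and remainders of the expansions in powers of `ε`. -/
def PolyGrowth (a : ℝ) (f : ℝ → ℝ → ℝ → ℝ) : Prop :=
  ∃ C : ℝ, ∃ k : ℕ, 0 ≤ C ∧
    ∀ r ∈ Icc a (1 - a), ∀ ε ∈ Icc (0 : ℝ) 1, ∀ u, |f r ε u| ≤ C * (1 + |u|) ^ k

namespace PolyGrowth

variable {a : ℝ} {f g : ℝ → ℝ → ℝ → ℝ}

lemma add (hf : PolyGrowth a f) (hg : PolyGrowth a g) :
    PolyGrowth a fun r ε u => f r ε u + g r ε u := by
  obtain ⟨C, k, hC, hf⟩ := hf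
  obtain ⟨D, l, hD, hg⟩ := hg
  refine ⟨C + D, max k l, by positivity, fun r hr ε hε u => ?_⟩
  have hu : 1 ≤ 1 + |u| := le_add_of_nonneg_right (abs_nonneg u)
  calc |f r ε u + g r ε u| ≤ |f r ε u| + |g r ε u| := abs_add_le _ _
    _ ≤ C * (1 + |u|) ^ k + D * (1 + |u|) ^ l := add_le_add (hf r hr ε hε u) (hg r hr ε hε u)
    _ ≤ C * (1 + |u|) ^ max k l + D * (1 + |u|) ^ max k l := by
        gcongr <;> first | exact hu | simp
    _ = (C + D) * (1 + |u|) ^ max k l := by ring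

lemma mul (hf : PolyGrowth a f) (hg : PolyGrowth a g) :
    PolyGrowth a fun r ε u => f r ε u * g r ε u := by
  obtain ⟨C, k, hC, hf⟩ := hf
  obtain ⟨D, l, hD, hg⟩ := hg
  refine ⟨C * D, k + l, by positivity, fun r hr ε hε u => ?_⟩
  calc |f r ε u * g r ε u| = |f r ε u| * |g r ε u| := abs_mul _ _
    _ ≤ C * (1 + |u|) ^ k * (D * (1 + |u|) ^ l) :=
        mul_le_mul (hf r hr ε hε u) (hg r hr ε hε u) (abs_nonneg _) (by positivity)
    _ = C * D * (1 + |u|) ^ (k + l) := by ring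

lemma coeff {c : ℝ → ℝ} (hc : ContinuousOn c (Icc a (1 - a))) : PolyGrowth a fun r _ _ => c r := by
  obtain ⟨C, hC⟩ := isCompact_Icc.exists_bound_of_continuousOn hc
  exact ⟨|C|, 0, abs_nonneg C, fun r hr _ _ _ => by simpa using (hC r hr).trans (le_abs_self C)⟩

lemma const (c : ℝ) : PolyGrowth a fun _ _ _ => c := coeff continuousOn_const

lemma eps : PolyGrowth a fun _ ε _ => ε :=
  ⟨1, 0, zero_le_one, fun _ _ ε hε _ => by simpa [abs_of_nonneg hε.1] using hε.2⟩

lemma var : PolyGrowth a fun _ _ u => u :=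
  ⟨1, 1, zero_le_one, fun _ _ _ _ u => by simp⟩

lemma neg (hf : PolyGrowth a f) : PolyGrowth a fun r ε u => -f r ε u := by
  simpa only [neg_one_mul] using (const (-1)).mul hf

lemma sub (hf : PolyGrowth a f) (hg : PolyGrowth a g) :
    PolyGrowth a fun r ε u => f r ε u - g r ε u := by
  simpa only [sub_eq_add_neg] using hf.add hg.neg

lemma div_const (hf : PolyGrowth a f) (c : ℝ) : PolyGrowth a fun r ε u => f r ε u / c := by
  simpa only [div_eq_mul_inv] using hf.mul (const c⁻¹)

lemma pow (hf : PolyGrowth a f) (n : ℕ) : PolyGrowth a fun r ε u => f r ε u ^ n := by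
  induction n with
  | zero => simpa only [pow_zero] using const 1
  | succ n ih => simpa only [pow_succ] using ih.mul hf

end PolyGrowth

lemma tendsto_mul_one_sub_log_pow_nhdsGT_zero (k : ℕ) :
    Tendsto (fun ε : ℝ => ε * (1 - 2 * Real.log ε) ^ k) (𝓝[>] 0) (𝓝 0) := by
  have hlog : Tendsto (fun ε => -Real.log ε) (𝓝[>] 0) atTop :=
    tendsto_neg_atBot_atTop.comp Real.tendsto_log_nhdsGT_zero
  have hlim := ((Real.tendsto_pow_mul_exp_neg_atTop_nhds_zero k).comp hlog).const_mul (3 ^ k)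
  rw [mul_zero] at hlim
  refine squeeze_zero' ?_ ?_ hlim <;>
    filter_upwards [hlog.eventually_ge_atTop 1, self_mem_nhdsWithin] with ε hε (hε0 : 0 < ε)
  · have : 0 ≤ 1 - 2 * Real.log ε := by linarith
    positivity
  · calc ε * (1 - 2 * Real.log ε) ^ k ≤ ε * (3 * -Real.log ε) ^ k := by
          gcongr <;> linarith
      _ = 3 ^ k * ((-Real.log ε) ^ k * Real.exp (- -Real.log ε)) := by
          rw [neg_neg, Real.exp_log hε0, mul_pow]
          ring

lemma eventually_mem_Ioo_nhdsGT_zero : ∀ᶠ ε : ℝ in 𝓝[>] 0, ε ∈ Ioo (0 : ℝ) 1 :=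
  Ioo_mem_nhdsGT zero_lt_one

lemma PolyGrowth.eventually_mul_abs_le {a : ℝ} {f : ℝ → ℝ → ℝ → ℝ} (hf : PolyGrowth a f) {δ : ℝ}
    (hδ : 0 < δ) :
    ∀ᶠ ε in 𝓝[>] 0, ∀ r ∈ Icc a (1 - a), ∀ u, |u| ≤ -2 * Real.log ε → ε * |f r ε u| ≤ δ := by
  obtain ⟨C, k, hC, hf⟩ := hf
  have hlim := (tendsto_mul_one_sub_log_pow_nhdsGT_zero k).const_mul C
  rw [mul_zero] at hlim
  filter_upwards [hlim.eventually_le_const hδ, eventually_mem_Ioo_nhdsGT_zero]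
    with ε hε ⟨hε0, hε1⟩ r hr u hu
  calc ε * |f r ε u| ≤ ε * (C * (1 + |u|) ^ k) := by
        gcongr
        exact hf r hr ε ⟨hε0.le, hε1.le⟩ u
    _ ≤ ε * (C * (1 - 2 * Real.log ε) ^ k) := by
        gcongr
        linarith
    _ ≤ δ := by linarith

/-- Third-order expansion `f r ε u = f₀ r u + f₁ r u * ε + f₂ r u * ε ^ 2 + O(ε ^ 3)`, with
coefficients and remainder of polynomial growth in `u`, uniformly for `r ∈ [a, 1 - a]` and
`ε ∈ [0, 1]`. -/
structure HasExpansion (a : ℝ) (f : ℝ → ℝ → ℝ → ℝ) (f₀ f₁ f₂ : ℝ → ℝ → ℝ) : Prop where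
  growth₀ : PolyGrowth a fun r _ u => f₀ r u
  growth₁ : PolyGrowth a fun r _ u => f₁ r u
  growth₂ : PolyGrowth a fun r _ u => f₂ r u
  exists_remainder : ∃ R, PolyGrowth a R ∧
    ∀ r ε u, f r ε u = f₀ r u + ε * f₁ r u + ε ^ 2 * f₂ r u + ε ^ 3 * R r ε u

namespace HasExpansion

variable {a : ℝ} {f g : ℝ → ℝ → ℝ → ℝ} {f₀ f₁ f₂ g₀ g₁ g₂ : ℝ → ℝ → ℝ}

lemma coeff (h : PolyGrowth a fun r _ u => f₀ r u) :
    HasExpansion a (fun r _ u => f₀ r u) f₀ 0 0 :=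
  ⟨h, .const 0, .const 0, 0, .const 0, fun r ε u => by simp⟩

lemma eps : HasExpansion a (fun _ ε _ => ε) 0 1 0 :=
  ⟨.const 0, .const 1, .const 0, 0, .const 0, fun r ε u => by simp⟩

lemma add (hf : HasExpansion a f f₀ f₁ f₂) (hg : HasExpansion a g g₀ g₁ g₂) :
    HasExpansion a (fun r ε u => f r ε u + g r ε u) (f₀ + g₀) (f₁ + g₁) (f₂ + g₂) := by
  obtain ⟨R, hR, hf'⟩ := hf.exists_remainder
  obtain ⟨S, hS, hg'⟩ := hg.exists_remainder
  refine ⟨hf.growth₀.add hg.growth₀, hf.growth₁.add hg.growth₁, hf.growth₂.add hg.growth₂, _,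
    hR.add hS, fun r ε u => ?_⟩
  simp only [hf', hg', Pi.add_apply]
  ring

lemma mul (hf : HasExpansion a f f₀ f₁ f₂) (hg : HasExpansion a g g₀ g₁ g₂) :
    HasExpansion a (fun r ε u => f r ε u * g r ε u)
      (f₀ * g₀) (f₀ * g₁ + f₁ * g₀) (f₀ * g₂ + f₁ * g₁ + f₂ * g₀) := by
  obtain ⟨R, hR, hf'⟩ := hf.exists_remainder
  obtain ⟨S, hS, hg'⟩ := hg.exists_remainder
  obtain ⟨F₀, F₁, F₂, -⟩ := hf
  obtain ⟨G₀, G₁, G₂, -⟩ := hg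
  refine ⟨F₀.mul G₀, (F₀.mul G₁).add (F₁.mul G₀), ((F₀.mul G₂).add (F₁.mul G₁)).add (F₂.mul G₀), _,
    ((F₁.mul G₂).add (F₂.mul G₁)).add (.add (PolyGrowth.eps.mul (F₂.mul G₂))
      (.add (.mul (.add (.add F₀ (PolyGrowth.eps.mul F₁)) ((PolyGrowth.eps.pow 2).mul F₂)) hS)
        (.mul hR (.add (.add (.add G₀ (PolyGrowth.eps.mul G₁)) ((PolyGrowth.eps.pow 2).mul G₂))
          ((PolyGrowth.eps.pow 3).mul hS))))), fun r ε u => ?_⟩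
  simp only [hf', hg', Pi.add_apply, Pi.mul_apply]
  ring

lemma sub (hf : HasExpansion a f f₀ f₁ f₂) (hg : HasExpansion a g g₀ g₁ g₂) :
    HasExpansion a (fun r ε u => f r ε u - g r ε u) (f₀ - g₀) (f₁ - g₁) (f₂ - g₂) := by
  obtain ⟨R, hR, hf'⟩ := hf.exists_remainder
  obtain ⟨S, hS, hg'⟩ := hg.exists_remainder
  refine ⟨hf.growth₀.sub hg.growth₀, hf.growth₁.sub hg.growth₁, hf.growth₂.sub hg.growth₂, _,
    hR.sub hS, fun r ε u => ?_⟩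
  simp only [hf', hg', Pi.sub_apply]
  ring

lemma eventually_abs_sub_le (hf : HasExpansion a f f₀ f₁ f₂) {δ : ℝ} (hδ : 0 < δ) :
    ∀ᶠ ε in 𝓝[>] 0, ∀ r ∈ Icc a (1 - a), ∀ u, |u| ≤ -2 * Real.log ε →
      |f r ε u - f₀ r u| ≤ δ := by
  obtain ⟨R, hR, hf'⟩ := hf.exists_remainder
  have hgrowth := (hf.growth₁.add (PolyGrowth.eps.mul hf.growth₂)).add
    ((PolyGrowth.eps.pow 2).mul hR)
  filter_upwards [hgrowth.eventually_mul_abs_le hδ, self_mem_nhdsWithin]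
    with ε hε (hε0 : 0 < ε) r hr u hu
  refine le_of_eq_of_le ?_ (hε r hr u hu)
  rw [← abs_of_pos hε0, ← abs_mul, abs_of_pos hε0, hf']
  congr 1
  ring

lemma exists_eq_pow_three_mul (hf : HasExpansion a f f₀ f₁ f₂)
    (h₀ : ∀ r ∈ Icc a (1 - a), ∀ u, f₀ r u = 0) (h₁ : ∀ r ∈ Icc a (1 - a), ∀ u, f₁ r u = 0)
    (h₂ : ∀ r ∈ Icc a (1 - a), ∀ u, f₂ r u = 0) :
    ∃ R, PolyGrowth a R ∧ ∀ r ∈ Icc a (1 - a), ∀ ε u, f r ε u = ε ^ 3 * R r ε u := by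
  obtain ⟨R, hR, hf'⟩ := hf.exists_remainder
  exact ⟨R, hR, fun r hr ε u => by rw [hf', h₀ r hr, h₁ r hr, h₂ r hr]; ring⟩

end HasExpansion

end Expansion

section CornishFisher

/-- Standard deviation of the Bernoulli distribution with success probability `r`. -/
noncomputable def bernoulliSD (r : ℝ) : ℝ := √(r * (1 - r))

/-- Two-term Cornish–Fisher polynomial in the standard normal variable `u` for the beta distribution
with parameters `x` and `n - x + 1`, centred at `r = x / n` and scaled by `ε = n ^ (-1/2)`. -/
noncomputable def cornishFisher (r ε u : ℝ) : ℝ :=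
  bernoulliSD r * u + ε * (((1 - 2 * r) * u ^ 2 - (1 + r)) / 3)
    + ε ^ 2 * (((1 - 13 * (r * (1 - r))) * u ^ 3 + (17 * r ^ 2 + r - 7) * u)
      * (36 * bernoulliSD r)⁻¹)

/-- The derivative of `cornishFisher r ε`. -/
noncomputable def cornishFisher' (r ε u : ℝ) : ℝ :=
  bernoulliSD r + ε * (2 * (1 - 2 * r) * u / 3)
    + ε ^ 2 * ((3 * (1 - 13 * (r * (1 - r))) * u ^ 2 + (17 * r ^ 2 + r - 7))
      * (36 * bernoulliSD r)⁻¹)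

/-- The second derivative of `cornishFisher r ε`. -/
noncomputable def cornishFisher'' (r ε u : ℝ) : ℝ :=
  ε * (2 * (1 - 2 * r) / 3)
    + ε ^ 2 * (6 * (1 - 13 * (r * (1 - r))) * u * (36 * bernoulliSD r)⁻¹)

/-- Cornish–Fisher approximation of the quantile of order `Φ u` of the beta distribution with
parameters `x = r * n` and `n - x + 1`, where `ε = n ^ (-1/2)`. -/
noncomputable def betaQuantileApprox (r ε u : ℝ) : ℝ := r + ε * cornishFisher r ε u

lemma bernoulliSD_pos {r : ℝ} (hr : r ∈ Ioo (0 : ℝ) 1) : 0 < bernoulliSD r :=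
  Real.sqrt_pos.2 (mul_pos hr.1 (sub_pos.2 hr.2))

lemma bernoulliSD_sq {r : ℝ} (hr : r ∈ Icc (0 : ℝ) 1) : bernoulliSD r ^ 2 = r * (1 - r) :=
  Real.sq_sqrt (mul_nonneg hr.1 (sub_nonneg.2 hr.2))

lemma continuous_bernoulliSD : Continuous bernoulliSD := by
  unfold bernoulliSD
  fun_prop

lemma Icc_subset_Ioo_zero_one {a : ℝ} (ha : 0 < a) : Icc a (1 - a) ⊆ Ioo (0 : ℝ) 1 :=
  Icc_subset_Ioo ha (by linarith)

lemma continuousOn_inv_bernoulliSD {a : ℝ} (ha : 0 < a) :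
    ContinuousOn (fun r => (36 * bernoulliSD r)⁻¹) (Icc a (1 - a)) :=
  (continuous_bernoulliSD.const_mul 36).continuousOn.inv₀ fun _ hr =>
    (mul_pos (by norm_num) (bernoulliSD_pos (Icc_subset_Ioo_zero_one ha hr))).ne'

lemma hasDerivAt_cornishFisher (r ε u : ℝ) :
    HasDerivAt (cornishFisher r ε) (cornishFisher' r ε u) u := by
  have h := (((hasDerivAt_id u).const_mul (bernoulliSD r)).add
    (((((hasDerivAt_pow 2 u).const_mul (1 - 2 * r)).sub_const (1 + r)).div_const 3).const_mul
      ε)).add (((((hasDerivAt_pow 3 u).const_mul (1 - 13 * (r * (1 - r)))).add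
    ((hasDerivAt_id u).const_mul (17 * r ^ 2 + r - 7))).mul_const
      (36 * bernoulliSD r)⁻¹).const_mul (ε ^ 2))
  refine h.congr_deriv ?_
  simp only [cornishFisher']
  push_cast
  ring

lemma hasDerivAt_cornishFisher' (r ε u : ℝ) :
    HasDerivAt (cornishFisher' r ε) (cornishFisher'' r ε u) u := by
  have h := (((((hasDerivAt_id u).const_mul (2 * (1 - 2 * r))).div_const 3).const_mul ε).const_add
    (bernoulliSD r)).add
    (((((hasDerivAt_pow 2 u).const_mul (3 * (1 - 13 * (r * (1 - r))))).add_const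
      (17 * r ^ 2 + r - 7)).mul_const (36 * bernoulliSD r)⁻¹).const_mul (ε ^ 2))
  refine h.congr_deriv ?_
  simp only [cornishFisher'']
  push_cast
  ring

lemma hasDerivAt_betaQuantileApprox (r ε u : ℝ) :
    HasDerivAt (betaQuantileApprox r ε) (ε * cornishFisher' r ε u) u :=
  ((hasDerivAt_cornishFisher r ε u).const_mul ε).const_add r

/-- The numerator of the logarithmic derivative of the ratio of the beta density, transported by
`betaQuantileApprox r ε`, to the standard normal density. -/
noncomputable def cornishFisherResidual (r ε u : ℝ) : ℝ :=
  (cornishFisher'' r ε u + u * cornishFisher' r ε u)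
      * (betaQuantileApprox r ε u * (1 - betaQuantileApprox r ε u))
    - (cornishFisher r ε u + ε * (1 - betaQuantileApprox r ε u)) * cornishFisher' r ε u ^ 2

lemma hasExpansion_cornishFisher_and_derivs {a : ℝ} (ha : 0 < a) :
    HasExpansion a cornishFisher (fun r u => bernoulliSD r * u)
      (fun r u => ((1 - 2 * r) * u ^ 2 - (1 + r)) / 3)
      (fun r u => ((1 - 13 * (r * (1 - r))) * u ^ 3 + (17 * r ^ 2 + r - 7) * u)
        * (36 * bernoulliSD r)⁻¹) ∧
    HasExpansion a cornishFisher' (fun r _ => bernoulliSD r) (fun r u => 2 * (1 - 2 * r) * u / 3)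
      (fun r u => (3 * (1 - 13 * (r * (1 - r))) * u ^ 2 + (17 * r ^ 2 + r - 7))
        * (36 * bernoulliSD r)⁻¹) ∧
    HasExpansion a cornishFisher'' 0 (fun r _ => 2 * (1 - 2 * r) / 3)
      (fun r u => 6 * (1 - 13 * (r * (1 - r))) * u * (36 * bernoulliSD r)⁻¹) := by
  have hσ := PolyGrowth.coeff (a := a) continuous_bernoulliSD.continuousOn
  have hσinv := PolyGrowth.coeff (continuousOn_inv_bernoulliSD ha)
  have hr : PolyGrowth a fun r _ _ => r := .coeff continuousOn_id
  refine ⟨⟨?_, ?_, ?_, 0, .const 0, fun r ε u => by simp [cornishFisher]⟩,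
    ⟨?_, ?_, ?_, 0, .const 0, fun r ε u => by simp [cornishFisher']⟩,
    ⟨.const 0, ?_, ?_, 0, .const 0, fun r ε u => by simp [cornishFisher'']⟩⟩ <;>
  with_reducible repeat' first
    | exact hσ | exact hσinv | exact hr | exact .var | exact .const _
    | apply PolyGrowth.add | apply PolyGrowth.sub | apply PolyGrowth.mul
    | apply PolyGrowth.pow | apply PolyGrowth.div_const

lemma hasExpansion_betaQuantileApprox {a : ℝ} (ha : 0 < a) :
    HasExpansion a betaQuantileApprox (fun r _ => r) (fun r u => bernoulliSD r * u)
      (fun r u => ((1 - 2 * r) * u ^ 2 - (1 + r)) / 3) := by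
  have hW := (hasExpansion_cornishFisher_and_derivs ha).1
  refine ⟨.coeff continuousOn_id, hW.growth₀, hW.growth₁, _, hW.growth₂, fun r ε u => ?_⟩
  rw [betaQuantileApprox, cornishFisher]
  ring

lemma exists_cornishFisherResidual_eq {a : ℝ} (ha : 0 < a) :
    ∃ R, PolyGrowth a R ∧ ∀ r ∈ Icc a (1 - a), ∀ ε u,
      cornishFisherResidual r ε u = ε ^ 3 * R r ε u := by
  obtain ⟨hW, hW', hW''⟩ := hasExpansion_cornishFisher_and_derivs ha
  have hT := hasExpansion_betaQuantileApprox ha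
  have hone : HasExpansion a (fun _ _ _ => 1) (fun _ _ => 1) 0 0 := .coeff (.const 1)
  have hu : HasExpansion a (fun _ _ u => u) (fun _ u => u) 0 0 := .coeff .var
  have hT1 := hone.sub hT
  have hres := ((hW''.add (hu.mul hW')).mul (hT.mul hT1)).sub
    ((hW.add (HasExpansion.eps.mul hT1)).mul (hW'.mul hW'))
  simp only [cornishFisherResidual, sq]
  refine hres.exists_eq_pow_three_mul ?_ ?_ ?_ <;> intro r hr u <;>
    have hσ := (bernoulliSD_pos (Icc_subset_Ioo_zero_one ha hr)).ne' <;>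
    have hsq := bernoulliSD_sq (Ioo_subset_Icc_self (Icc_subset_Ioo_zero_one ha hr)) <;>
    simp only [Pi.add_apply, Pi.sub_apply, Pi.mul_apply, Pi.zero_apply, Pi.one_apply]
  · linear_combination (-bernoulliSD r * u) * hsq
  · linear_combination (-(2 * (1 - 2 * r) * (1 + u ^ 2) / 3)) * hsq
  · field_simp
    linear_combination 9 *
      ((36 * u - 36 * u ^ 3) * (bernoulliSD r ^ 2 + r * (1 - r))
      + 12 * (1 - 2 * r) * u * ((1 - 2 * r) * u ^ 2 - (1 + r))
      + 24 * (1 - 2 * r) ^ 2 * u * (1 + u ^ 2) - 16 * (1 - 2 * r) ^ 2 * u ^ 3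
      - 2 * u * (3 * (1 - 13 * (r * (1 - r))) * u ^ 2 + (17 * r ^ 2 + r - 7))
      - 16 * ((1 - 2 * r) * u ^ 2 + 2 - 4 * r) * (1 - 2 * r) * u
      - ((1 - 13 * (r * (1 - r))) * u ^ 3 + (17 * r ^ 2 + r - 7) * u)) * hsq

end CornishFisher

section BetaDensity

/-- A sample with `x = y + 1` successes in `n = m + 1` trials, with proportion `r = x / n` bounded
away from `0` and `1`, and `ε = n ^ (-1/2)` up to sign. -/
structure IsSample (a : ℝ) (m y : ℕ) (r ε : ℝ) : Prop where
  mem_Icc : r ∈ Icc a (1 - a)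
  eps_sq_mul : ε ^ 2 * (m + 1) = 1
  ratio_mul : r * (m + 1) = y + 1

/-- The density of the beta distribution with parameters `y + 1` and `m - y + 1`. -/
noncomputable def betaDensity (m y : ℕ) (t : ℝ) : ℝ :=
  ((m : ℝ) + 1) * ((m.choose y : ℝ) * t ^ y * (1 - t) ^ (m - y))

/-- Logarithm of the ratio of the beta density, transported by `betaQuantileApprox r ε`, to the
standard normal density, up to an additive constant. -/
noncomputable def logDensityRatio (m y : ℕ) (r ε u : ℝ) : ℝ :=
  y * Real.log (betaQuantileApprox r ε u) + (m - y : ℝ) * Real.log (1 - betaQuantileApprox r ε u)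
    + Real.log (cornishFisher' r ε u) + u ^ 2 / 2

lemma eventually_betaQuantileApprox_mem_Icc {a : ℝ} (ha : 0 < a) :
    ∀ᶠ ε in 𝓝[>] 0, ∀ r ∈ Icc a (1 - a), ∀ u, |u| ≤ -2 * Real.log ε →
      betaQuantileApprox r ε u ∈ Icc (a / 2) (1 - a / 2) := by
  filter_upwards [(hasExpansion_betaQuantileApprox ha).eventually_abs_sub_le (half_pos ha)]
    with ε hε r hr u hu
  obtain ⟨hl, hu⟩ := abs_le.1 (hε r hr u hu)
  exact ⟨by linarith [hr.1], by linarith [hr.2]⟩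

lemma bernoulliSD_mem_Icc {a r : ℝ} (ha : 0 < a) (hr : r ∈ Icc a (1 - a)) :
    bernoulliSD r ∈ Icc a 1 :=
  ⟨Real.le_sqrt_of_sq_le (by nlinarith [hr.1, hr.2]),
    Real.sqrt_le_one.2 (by nlinarith [sq_nonneg (1 - 2 * r)])⟩

lemma eventually_cornishFisher'_mem_Icc {a : ℝ} (ha : 0 < a) :
    ∀ᶠ ε in 𝓝[>] 0, ∀ r ∈ Icc a (1 - a), ∀ u, |u| ≤ -2 * Real.log ε →
      cornishFisher' r ε u ∈ Icc (a / 2) 2 := by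
  have hW' := (hasExpansion_cornishFisher_and_derivs ha).2.1
  filter_upwards [hW'.eventually_abs_sub_le (half_pos ha)] with ε hε r hr u hu
  obtain ⟨hl, hu⟩ := abs_le.1 (hε r hr u hu)
  obtain ⟨hσa, hσ1⟩ := bernoulliSD_mem_Icc ha hr
  exact ⟨by linarith, by linarith⟩

lemma IsSample.le {a r ε : ℝ} {m y : ℕ} (h : IsSample a m y r ε) (ha : 0 < a) : y ≤ m := by
  have hr : r * (m + 1) ≤ 1 * (m + 1) := by
    gcongr
    linarith [h.mem_Icc.2]
  rw [h.ratio_mul, one_mul, add_le_add_iff_right] at hr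
  exact_mod_cast hr

lemma IsSample.eps_mul_sub {a r ε : ℝ} {m y : ℕ} (h : IsSample a m y r ε) (hε : 0 < ε) (u : ℝ) :
    ε * (y - m * betaQuantileApprox r ε u)
      = -(cornishFisher r ε u + ε * (1 - betaQuantileApprox r ε u)) := by
  refine mul_left_cancel₀ hε.ne' ?_
  have hy : (y : ℝ) = r * (m + 1) - 1 := by linarith [h.ratio_mul]
  rw [hy, betaQuantileApprox]
  linear_combination (-ε * cornishFisher r ε u) * h.eps_sq_mul

lemma IsSample.hasDerivAt_logDensityRatio {a r ε u : ℝ} {m y : ℕ} (h : IsSample a m y r ε)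
    (hε : 0 < ε) (hT : betaQuantileApprox r ε u ∈ Ioo (0 : ℝ) 1)
    (hW : 0 < cornishFisher' r ε u) :
    HasDerivAt (logDensityRatio m y r ε)
      (cornishFisherResidual r ε u / (betaQuantileApprox r ε u * (1 - betaQuantileApprox r ε u)
        * cornishFisher' r ε u)) u := by
  obtain ⟨hT0, hT1⟩ : betaQuantileApprox r ε u ≠ 0 ∧ 1 - betaQuantileApprox r ε u ≠ 0 :=
    ⟨hT.1.ne', (sub_pos.2 hT.2).ne'⟩
  have hder := hasDerivAt_betaQuantileApprox r ε u
  have hd := ((((hder.log hT0).const_mul (y : ℝ)).add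
    (((hder.const_sub 1).log hT1).const_mul (m - y : ℝ))).add
    ((hasDerivAt_cornishFisher' r ε u).log hW.ne')).add ((hasDerivAt_pow 2 u).div_const 2)
  refine hd.congr_deriv ?_
  have hcoef := h.eps_mul_sub hε u
  have hW' := hW.ne'
  rw [cornishFisherResidual]
  generalize betaQuantileApprox r ε u = T at *
  generalize cornishFisher' r ε u = V at *
  field_simp
  push_cast
  linear_combination 2 * V ^ 2 * hcoef

lemma betaDensity_mul_eq {m y : ℕ} (hy : y ≤ m) {r ε u : ℝ}
    (hT : betaQuantileApprox r ε u ∈ Ioo (0 : ℝ) 1) (hW : 0 < cornishFisher' r ε u) :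
    betaDensity m y (betaQuantileApprox r ε u) * (ε * cornishFisher' r ε u)
      = ((m : ℝ) + 1) * m.choose y * ε * √(2 * Real.pi)
        * Real.exp (logDensityRatio m y r ε u) * gaussianPDFReal 0 1 u := by
  have hexp : Real.exp (logDensityRatio m y r ε u) = betaQuantileApprox r ε u ^ y
      * (1 - betaQuantileApprox r ε u) ^ (m - y) * cornishFisher' r ε u
      * Real.exp (u ^ 2 / 2) := by
    rw [logDensityRatio, Real.exp_add, Real.exp_add, Real.exp_add, Real.exp_log hW,
      Real.exp_nat_mul, Real.exp_log hT.1, ← Nat.cast_sub hy, Real.exp_nat_mul,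
      Real.exp_log (sub_pos.2 hT.2)]
  have hcancel : Real.exp (u ^ 2 / 2) * Real.exp (-(u ^ 2 / 2)) = 1 := by
    rw [← Real.exp_add, add_neg_cancel, Real.exp_zero]
  have hpdf : √(2 * Real.pi) * gaussianPDFReal 0 1 u = Real.exp (-(u ^ 2 / 2)) := by
    have : √(2 * Real.pi) ≠ 0 := by positivity
    simp only [gaussianPDFReal, NNReal.coe_one, mul_one, sub_zero, neg_div]
    field_simp
  rw [hexp, betaDensity]
  linear_combination (-(m + 1 : ℝ) * m.choose y * ε * betaQuantileApprox r ε u ^ y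
    * (1 - betaQuantileApprox r ε u) ^ (m - y) * cornishFisher' r ε u)
    * (Real.exp (u ^ 2 / 2) * hpdf + hcancel)

lemma exists_abs_cornishFisherResidual_div_le {a : ℝ} (ha : 0 < a) :
    ∃ C : ℝ, ∃ k : ℕ, 0 ≤ C ∧ ∀ᶠ ε in 𝓝[>] 0, ∀ r ∈ Icc a (1 - a), ∀ u, |u| ≤ -2 * Real.log ε →
      |cornishFisherResidual r ε u / (betaQuantileApprox r ε u * (1 - betaQuantileApprox r ε u)
        * cornishFisher' r ε u)| ≤ C * ε ^ 3 * (1 + |u|) ^ k := by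
  obtain ⟨R, ⟨C, k, hC, hR⟩, hres⟩ := exists_cornishFisherResidual_eq ha
  refine ⟨C / (a / 2) ^ 3, k, by positivity, ?_⟩
  filter_upwards [eventually_betaQuantileApprox_mem_Icc ha, eventually_cornishFisher'_mem_Icc ha,
    eventually_mem_Ioo_nhdsGT_zero] with ε hT hW hε r hr u hu
  obtain ⟨hTl, hTu⟩ := hT r hr u hu
  have hden : (a / 2) ^ 3 ≤ betaQuantileApprox r ε u * (1 - betaQuantileApprox r ε u)
      * cornishFisher' r ε u := by
    rw [pow_succ, sq]
    gcongr
    · exact mul_nonneg (by linarith) (by linarith)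
    · linarith
    · linarith
    · exact (hW r hr u hu).1
  have hε0 := hε.1
  rw [abs_div, abs_of_pos (lt_of_lt_of_le (by positivity) hden), hres r hr, abs_mul,
    abs_of_pos (pow_pos hε0 3)]
  calc ε ^ 3 * |R r ε u| / _ ≤ ε ^ 3 * (C * (1 + |u|) ^ k) / (a / 2) ^ 3 := by
        gcongr
        exact hR r hr ε (Ioo_subset_Icc_self hε) u
    _ = _ := by ring

lemma exists_abs_logDensityRatio_sub_le {a : ℝ} (ha : 0 < a) :
    ∃ C : ℝ, ∃ k : ℕ, 0 ≤ C ∧ ∀ᶠ ε in 𝓝[>] 0, ∀ m y r, IsSample a m y r ε →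
      ∀ u, |u| ≤ -2 * Real.log ε →
        |logDensityRatio m y r ε u - logDensityRatio m y r ε 0| ≤ C * ε ^ 3 * (1 + |u|) ^ k := by
  obtain ⟨C, k, hC, hbound⟩ := exists_abs_cornishFisherResidual_div_le ha
  refine ⟨C, k + 1, hC, ?_⟩
  filter_upwards [hbound, eventually_betaQuantileApprox_mem_Icc ha,
    eventually_cornishFisher'_mem_Icc ha, self_mem_nhdsWithin]
    with ε hbound hT hW (hε : 0 < ε) m y r h u hu
  have hderiv (t : ℝ) (ht : t ∈ Icc (-|u|) |u|) :
      HasDerivAt (logDensityRatio m y r ε) (cornishFisherResidual r ε t /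
        (betaQuantileApprox r ε t * (1 - betaQuantileApprox r ε t) * cornishFisher' r ε t)) t := by
    have htu := (abs_le.2 ht).trans hu
    have hTt := hT r h.mem_Icc t htu
    exact h.hasDerivAt_logDensityRatio hε ⟨by linarith [hTt.1], by linarith [hTt.2]⟩
      (by linarith [(hW r h.mem_Icc t htu).1])
  have hmvt := (convex_Icc (-|u|) |u|).norm_image_sub_le_of_norm_hasDerivWithin_le
    (C := C * ε ^ 3 * (1 + |u|) ^ k) (fun t ht => (hderiv t ht).hasDerivWithinAt)
    (fun t ht => (hbound r h.mem_Icc t ((abs_le.2 ht).trans hu)).trans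
      (mul_le_mul_of_nonneg_left (pow_le_pow_left₀ (by positivity)
        (add_le_add_right (abs_le.2 ht) 1) k) (by positivity)))
    (show (0 : ℝ) ∈ Icc (-|u|) |u| by simp) (abs_le.1 le_rfl)
  calc |logDensityRatio m y r ε u - logDensityRatio m y r ε 0|
      ≤ C * ε ^ 3 * (1 + |u|) ^ k * |u| := by
        simpa only [Real.norm_eq_abs, sub_zero] using hmvt
    _ ≤ C * ε ^ 3 * (1 + |u|) ^ k * (1 + |u|) := by
        gcongr
        exact le_add_of_nonneg_left zero_le_one
    _ = _ := by ring

lemma abs_exp_sub_exp_le {s t b : ℝ} (h : |s - t| ≤ b) (hb : b ≤ 1) :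
    |Real.exp s - Real.exp t| ≤ Real.exp t * (2 * b) := by
  calc |Real.exp s - Real.exp t| = Real.exp t * |Real.exp (s - t) - 1| := by
        rw [← abs_of_pos (Real.exp_pos t), ← abs_mul, mul_sub, abs_of_pos (Real.exp_pos t),
          ← Real.exp_add, add_sub_cancel, mul_one]
    _ ≤ Real.exp t * (2 * b) := by
        gcongr
        exact (Real.abs_exp_sub_one_le (h.trans hb)).trans (by gcongr)

lemma exists_abs_betaDensity_sub_le {a : ℝ} (ha : 0 < a) :
    ∃ C : ℝ, ∃ k : ℕ, 0 ≤ C ∧ ∀ᶠ ε in 𝓝[>] 0, ∀ m y r, IsSample a m y r ε →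
      ∃ K > 0, ∀ u, |u| ≤ -2 * Real.log ε →
        |betaDensity m y (betaQuantileApprox r ε u) * (ε * cornishFisher' r ε u)
            - K * gaussianPDFReal 0 1 u|
          ≤ K * gaussianPDFReal 0 1 u * (C * ε ^ 3 * (1 + |u|) ^ k) := by
  obtain ⟨C, k, hC, hlog⟩ := exists_abs_logDensityRatio_sub_le ha
  refine ⟨2 * C, k, by positivity, ?_⟩
  have hgrowth : PolyGrowth a fun _ ε u => ε ^ 2 * (C * (1 + |u|) ^ k) :=
    (PolyGrowth.eps.pow 2).mul ⟨C, k, hC, fun r _ ε _ u => by rw [abs_of_nonneg (by positivity)]⟩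
  filter_upwards [hlog, hgrowth.eventually_mul_abs_le zero_lt_one,
    eventually_betaQuantileApprox_mem_Icc ha, eventually_cornishFisher'_mem_Icc ha,
    self_mem_nhdsWithin] with ε hlog hsmall hT hW (hε : 0 < ε) m y r h
  have hchoose : (0 : ℝ) < m.choose y := mod_cast Nat.choose_pos (h.le ha)
  refine ⟨(m + 1) * m.choose y * ε * √(2 * Real.pi) * Real.exp (logDensityRatio m y r ε 0),
    by positivity, fun u hu => ?_⟩
  have hTu := hT r h.mem_Icc u hu
  have hWu := hW r h.mem_Icc u hu
  have hφ := gaussianPDFReal_nonneg 0 1 u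
  have hone : C * ε ^ 3 * (1 + |u|) ^ k ≤ 1 := by
    have hle := hsmall r h.mem_Icc u hu
    rw [abs_of_nonneg (by positivity)] at hle
    linarith
  have hexp := abs_exp_sub_exp_le (hlog m y r h u hu) hone
  rw [betaDensity_mul_eq (h.le ha) ⟨by linarith [hTu.1], by linarith [hTu.2]⟩
    (by linarith [hWu.1]), ← sub_mul, ← mul_sub, abs_mul, abs_of_nonneg hφ, abs_mul,
    abs_of_nonneg (by positivity : 0 ≤ ((m : ℝ) + 1) * m.choose y * ε * √(2 * Real.pi))]
  calc _ ≤ ((m : ℝ) + 1) * m.choose y * ε * √(2 * Real.pi)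
        * (Real.exp (logDensityRatio m y r ε 0) * (2 * (C * ε ^ 3 * (1 + |u|) ^ k)))
        * gaussianPDFReal 0 1 u := by gcongr
    _ = _ := by ring

end BetaDensity

section Endpoint

lemma tendsto_neg_two_mul_log_nhdsGT_zero :
    Tendsto (fun ε : ℝ => -2 * Real.log ε) (𝓝[>] 0) atTop :=
  Real.tendsto_log_nhdsGT_zero.const_mul_atBot_of_neg (by norm_num)

lemma eventually_exp_neg_mul_log_sq_le {c : ℝ} (hc : 0 < c) :
    ∀ᶠ ε in 𝓝[>] 0, Real.exp (-(c * Real.log ε ^ 2)) ≤ ε ^ 3 := by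
  filter_upwards [tendsto_neg_two_mul_log_nhdsGT_zero.eventually_ge_atTop (6 / c),
    eventually_mem_Ioo_nhdsGT_zero] with ε hε ⟨hε0, hε1⟩
  rw [← Real.le_log_iff_exp_le (pow_pos hε0 3), Real.log_pow, Nat.cast_ofNat]
  rw [div_le_iff₀ hc] at hε
  nlinarith [Real.log_neg hε0 hε1]

lemma eventually_cornishFisher_tails {a : ℝ} (ha : 0 < a) :
    ∀ᶠ ε in 𝓝[>] 0, ∀ r ∈ Icc a (1 - a),
      cornishFisher r ε (2 * Real.log ε) ≤ a * Real.log ε ∧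
        -(a * Real.log ε) ≤ cornishFisher r ε (-2 * Real.log ε) := by
  filter_upwards [(hasExpansion_cornishFisher_and_derivs ha).1.eventually_abs_sub_le (half_pos ha),
    tendsto_neg_two_mul_log_nhdsGT_zero.eventually_ge_atTop 1] with ε hε hlog r hr
  have hσ := (bernoulliSD_mem_Icc ha hr).1
  have hl := (abs_le.1 (hε r hr (2 * Real.log ε) (by rw [abs_of_neg (by linarith)]; linarith))).2
  have hu := (abs_le.1 (hε r hr (-2 * Real.log ε) (by rw [abs_of_pos (by linarith)]))).1
  constructor <;> nlinarith

lemma IsSample.mul_betaQuantileApprox {a r ε : ℝ} {m y : ℕ} (h : IsSample a m y r ε) (u : ℝ) :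
    ((m + 1 : ℕ) : ℝ) * betaQuantileApprox r ε u
      = y + 1 + (m + 1) * ε * cornishFisher r ε u := by
  rw [betaQuantileApprox]
  push_cast
  linear_combination h.ratio_mul

lemma IsSample.sq_mul_div {a r ε : ℝ} {m y : ℕ} (h : IsSample a m y r ε) (w : ℝ) :
    ((m + 1) * ε * w) ^ 2 / (4 * ((m + 1 : ℕ) : ℝ)) = w ^ 2 / 4 := by
  push_cast
  field_simp
  linear_combination w ^ 2 * h.eps_sq_mul

lemma eventually_binomialUpperTail_betaQuantileApprox_le {a : ℝ} (ha : 0 < a) :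
    ∀ᶠ ε in 𝓝[>] 0, ∀ m y r, IsSample a m y r ε →
      binomialUpperTail (m + 1) (y + 1) (betaQuantileApprox r ε (2 * Real.log ε)) ≤ ε ^ 3 ∧
        1 - binomialUpperTail (m + 1) (y + 1) (betaQuantileApprox r ε (-2 * Real.log ε))
          ≤ ε ^ 3 := by
  filter_upwards [eventually_cornishFisher_tails ha, eventually_betaQuantileApprox_mem_Icc ha,
    eventually_exp_neg_mul_log_sq_le (by positivity : 0 < a ^ 2 / 4),
    eventually_mem_Ioo_nhdsGT_zero] with ε hW hT hexp ⟨hε0, hε1⟩ m y r h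
  have hlog := Real.log_neg hε0 hε1
  have halog := mul_neg_of_pos_of_neg ha hlog
  have hy := h.le ha
  obtain ⟨hWl, hWu⟩ := hW r h.mem_Icc
  have hnε : 0 < (m + 1) * ε := by positivity
  have hT01 (u : ℝ) (hu : |u| ≤ -2 * Real.log ε) : betaQuantileApprox r ε u ∈ Icc (0 : ℝ) 1 := by
    have := hT r h.mem_Icc u hu
    exact ⟨by linarith [this.1], by linarith [this.2]⟩
  constructor
  · have hneg := mul_nonpos_of_nonneg_of_nonpos hnε.le (hWl.trans halog.le)
    have hT0 := hT01 (2 * Real.log ε) (by rw [abs_of_neg (by linarith)]; linarith)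
    refine (binomialUpperTail_le_exp (by omega) hT0
      (by rw [h.mul_betaQuantileApprox]; push_cast; linarith)).trans (le_trans ?_ hexp)
    rw [h.mul_betaQuantileApprox, Nat.cast_succ y, sub_add_cancel_left, neg_sq, h.sq_mul_div]
    gcongr
    nlinarith
  · have hpos := mul_nonneg hnε.le (by linarith : 0 ≤ cornishFisher r ε (-2 * Real.log ε))
    rw [← binomialLowerTail_eq _ _ (by omega)]
    refine (binomialLowerTail_le_exp (by omega) (hT01 _ (by rw [abs_of_pos (by linarith)]))
      (by rw [h.mul_betaQuantileApprox]; linarith)).trans (le_trans ?_ hexp)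
    calc _ ≤ Real.exp (-(((m + 1) * ε * cornishFisher r ε (-2 * Real.log ε)) ^ 2
          / (4 * ((m + 1 : ℕ) : ℝ)))) := by
          rw [h.mul_betaQuantileApprox]
          gcongr
          linarith
      _ ≤ _ := by
          rw [h.sq_mul_div]
          gcongr
          nlinarith

lemma exists_abs_binomialUpperTail_sub_cdf_le {a : ℝ} (ha : 0 < a) :
    ∃ C : ℝ, ∀ᶠ ε in 𝓝[>] 0, ∀ m y r, IsSample a m y r ε →
      ∀ u, |u| ≤ -2 * Real.log ε →
        |binomialUpperTail (m + 1) (y + 1) (betaQuantileApprox r ε u) - cdf (gaussianReal 0 1) u|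
          ≤ C * ε ^ 3 := by
  obtain ⟨C, k, hC, hdensity⟩ := exists_abs_betaDensity_sub_le ha
  refine ⟨6 * (1 + C * ∫ t, gaussianPDFReal 0 1 t * (1 + |t|) ^ k), ?_⟩
  filter_upwards [hdensity, eventually_binomialUpperTail_betaQuantileApprox_le ha,
    eventually_betaQuantileApprox_mem_Icc ha, eventually_exp_neg_mul_log_sq_le two_pos,
    eventually_mem_Ioo_nhdsGT_zero] with ε hdensity htails hT hexp ⟨hε0, hε1⟩ m y r h u hu
  obtain ⟨K, hK, hf⟩ := hdensity m y r h
  obtain ⟨hl, hu'⟩ := htails m y r h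
  have hlog := Real.log_neg hε0 hε1
  refine (abs_sub_cdf_stdNormal_le (M := -2 * Real.log ε) (τ := ε ^ 3) (j := k)
    (F := fun t => binomialUpperTail (m + 1) (y + 1) (betaQuantileApprox r ε t)) hK
    (by positivity : 0 ≤ C * ε ^ 3) (fun t ht => ?_) (fun t _ => ?_)
    (fun t ht => hf t (abs_le.2 ht)) ?_ hu' ?_ (abs_le.1 hu)).trans_eq (by ring)
  · have hTt := hT r h.mem_Icc t (abs_le.2 ht)
    exact binomialUpperTail_mem_Icc _ _ ⟨by linarith [hTt.1], by linarith [hTt.2]⟩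
  · exact (binomialUpperTail_hasDerivAt m y (h.le ha) _).comp t
      (hasDerivAt_betaQuantileApprox r ε t)
  · simpa only [neg_mul, neg_neg] using hl
  · exact (cdf_stdNormal_neg_le (by linarith)).trans (le_of_eq_of_le (by ring_nf) hexp)

lemma abs_sub_le_of_abs_comp_sub_cdf_le {U T : ℝ → ℝ} {P w δ L : ℝ}
    (hU : StrictMonoOn U (Icc 0 1)) (hP : P ∈ Icc (0 : ℝ) 1)
    (hUP : U P = cdf (gaussianReal 0 1) w) (hδ : 0 ≤ δ) (hδ1 : δ ≤ gaussianPDFReal 0 1 (|w| + 1))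
    (hT : ∀ u, |u| ≤ |w| + 1 → T u ∈ Icc (0 : ℝ) 1 ∧
      |U (T u) - cdf (gaussianReal 0 1) u| ≤ δ ∧ |T u - T w| ≤ L * |u - w|) :
    |P - T w| ≤ L * (δ / gaussianPDFReal 0 1 (|w| + 1)) := by
  have hc : 0 < gaussianPDFReal 0 1 (|w| + 1) := gaussianPDFReal_pos 0 1 _ one_ne_zero
  set η := δ / gaussianPDFReal 0 1 (|w| + 1)
  have hη0 : 0 ≤ η := by positivity
  have hη1 : η ≤ 1 := (div_le_one hc).2 hδ1
  have hcη : gaussianPDFReal 0 1 (|w| + 1) * η = δ := mul_div_cancel₀ δ hc.ne'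
  have hw := abs_le.1 (le_refl |w|)
  obtain ⟨hl01, hl, hlT⟩ := hT (w - η) (abs_le.2 ⟨by linarith, by linarith⟩)
  obtain ⟨hu01, hu, huT⟩ := hT (w + η) (abs_le.2 ⟨by linarith, by linarith⟩)
  have hΦl := gaussianPDFReal_mul_sub_le_cdf_sub (v := 1) one_ne_zero
    (by linarith : w - η ≤ w) (B := |w| + 1) (by linarith) (by linarith)
  have hΦu := gaussianPDFReal_mul_sub_le_cdf_sub (v := 1) one_ne_zero
    (by linarith : w ≤ w + η) (B := |w| + 1) (by linarith) (by linarith)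
  rw [sub_sub_cancel, hcη] at hΦl
  rw [add_sub_cancel_left, hcη] at hΦu
  have hPl : T (w - η) ≤ P := (hU.le_iff_le hl01 hP).1 (by linarith [(abs_le.1 hl).2])
  have hPu : P ≤ T (w + η) := (hU.le_iff_le hP hu01).1 (by linarith [(abs_le.1 hu).1])
  rw [sub_sub_cancel_left, abs_neg, abs_of_nonneg hη0] at hlT
  rw [add_sub_cancel_left, abs_of_nonneg hη0] at huT
  exact abs_le.2 ⟨by linarith [(abs_le.1 hlT).1], by linarith [(abs_le.1 huT).2]⟩

lemma abs_betaQuantileApprox_sub_le {r ε M u v : ℝ} (hε : 0 ≤ ε)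
    (h : ∀ t, |t| ≤ M → cornishFisher' r ε t ∈ Icc 0 2) (hu : |u| ≤ M) (hv : |v| ≤ M) :
    |betaQuantileApprox r ε u - betaQuantileApprox r ε v| ≤ 2 * ε * |u - v| := by
  refine (convex_Icc (-M) M).norm_image_sub_le_of_norm_hasDerivWithin_le
    (fun t _ => (hasDerivAt_betaQuantileApprox r ε t).hasDerivWithinAt) (fun t ht => ?_)
    (abs_le.1 hv) (abs_le.1 hu)
  obtain ⟨h0, h2⟩ := h t (abs_le.2 ht)
  rw [Real.norm_eq_abs, abs_of_nonneg (mul_nonneg hε h0), mul_comm]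
  gcongr

lemma exists_abs_clopperPearsonLower_succ_sub_le {a α : ℝ} (ha : 0 < a) (hα : α ∈ Ioo (0 : ℝ) 1) :
    ∃ C : ℝ, ∀ᶠ ε in 𝓝[>] 0, ∀ m y r, IsSample a m y r ε →
      |clopperPearsonLower (m + 1) α (y + 1)
        - betaQuantileApprox r ε (-stdNormalUpperQuantile (α / 2))| ≤ C * ε ^ 4 := by
  obtain ⟨C, hcdf⟩ := exists_abs_binomialUpperTail_sub_cdf_le ha
  set w := -stdNormalUpperQuantile (α / 2)
  have hΦw : cdf (gaussianReal 0 1) w = α / 2 :=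
    cdf_neg_stdNormalUpperQuantile ⟨by linarith [hα.1], by linarith [hα.2]⟩
  have hc : 0 < gaussianPDFReal 0 1 (|w| + 1) := gaussianPDFReal_pos 0 1 _ one_ne_zero
  refine ⟨2 * |C| / gaussianPDFReal 0 1 (|w| + 1), ?_⟩
  have hlim : Tendsto (fun ε : ℝ => |C| * ε ^ 3) (𝓝[>] 0) (𝓝 0) := by
    have : Tendsto (fun ε : ℝ => |C| * ε ^ 3) (𝓝 0) (𝓝 (|C| * 0 ^ 3)) :=
      (continuous_const.mul (continuous_pow 3)).tendsto 0
    simpa using this.mono_left nhdsWithin_le_nhds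
  filter_upwards [hcdf, eventually_betaQuantileApprox_mem_Icc ha,
    eventually_cornishFisher'_mem_Icc ha, hlim.eventually_le_const hc,
    tendsto_neg_two_mul_log_nhdsGT_zero.eventually_ge_atTop (|w| + 1), self_mem_nhdsWithin]
    with ε hcdf hT hW hδ hM (hε : 0 < ε) m y r h
  obtain ⟨hP, hUP⟩ := clopperPearsonLower_spec (m + 1) (y + 1) y.succ_ne_zero
    (Nat.succ_le_succ (h.le ha)) α hα
  refine (abs_sub_le_of_abs_comp_sub_cdf_le (L := 2 * ε)
    (binomialUpperTail_strictMonoOn _ _ y.succ_ne_zero (Nat.succ_le_succ (h.le ha))) hP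
    (hUP.trans hΦw.symm) (by positivity) hδ fun u hu => ⟨?_, ?_, ?_⟩).trans_eq (by ring)
  · have hTu := hT r h.mem_Icc u (hu.trans hM)
    exact ⟨by linarith [hTu.1], by linarith [hTu.2]⟩
  · refine (hcdf m y r h u (hu.trans hM)).trans ?_
    gcongr
    exact le_abs_self C
  · refine abs_betaQuantileApprox_sub_le hε.le (fun t ht => ?_) (hu.trans hM)
      (by linarith : |w| ≤ -2 * Real.log ε)
    have hWt := hW r h.mem_Icc t ht
    exact ⟨by linarith [hWt.1], hWt.2⟩

end Endpoint

section CentralMoment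

open Polynomial

variable (R : Type*) [CommRing R]

/-- The `j`-th central moment of the binomial distribution with `n` trials, as a polynomial in the
success probability. -/
noncomputable def binomialCentralMoment (n j : ℕ) : R[X] :=
  ∑ k ∈ Finset.range (n + 1), ((k : R[X]) - (n : R[X]) * X) ^ j * bernsteinPolynomial R n k

lemma X_mul_one_sub_X_mul_derivative_bernsteinPolynomial (n k : ℕ) :
    (X : R[X]) * (1 - X) * derivative (bernsteinPolynomial R n k)
      = ((k : R[X]) - (n : R[X]) * X) * bernsteinPolynomial R n k := by
  rcases lt_or_ge n k with hk | hk
  · simp [bernsteinPolynomial.eq_zero_of_lt R hk]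
  obtain ⟨l, rfl⟩ := Nat.exists_eq_add_of_le hk
  have hpow (p : R[X]) (i : ℕ) : p * ((i : R[X]) * p ^ (i - 1)) = i * p ^ i := by
    cases i with
    | zero => simp
    | succ i => rw [Nat.add_sub_cancel]; ring
  simp only [bernsteinPolynomial, Nat.add_sub_cancel_left, derivative_mul, derivative_natCast,
    derivative_pow, derivative_sub, derivative_one, derivative_X, zero_sub,
    zero_mul, zero_add, map_natCast, Nat.cast_add]
  linear_combination ((k + l).choose k : R[X]) * ((1 - X) * (1 - X) ^ l * hpow X k
    - X * X ^ k * hpow (1 - X) l)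

lemma binomialCentralMoment_succ (n j : ℕ) :
    binomialCentralMoment R n (j + 1) = (X : R[X]) * (1 - X) *
      (derivative (binomialCentralMoment R n j)
        + ((n * j : ℕ) : R[X]) * binomialCentralMoment R n (j - 1)) := by
  simp only [binomialCentralMoment, derivative_sum, Finset.mul_sum, ← Finset.sum_add_distrib]
  refine Finset.sum_congr rfl fun k _ => ?_
  have hB := X_mul_one_sub_X_mul_derivative_bernsteinPolynomial R n k
  simp only [derivative_mul, derivative_pow, derivative_sub, derivative_natCast, derivative_X,
    map_natCast, Nat.cast_mul]
  linear_combination (-((k : R[X]) - (n : R[X]) * X) ^ j) * hB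

lemma binomialCentralMoment_zero (n : ℕ) : binomialCentralMoment R n 0 = 1 := by
  simp only [binomialCentralMoment, pow_zero, one_mul, bernsteinPolynomial.sum]

lemma binomialCentralMoment_one (n : ℕ) : binomialCentralMoment R n 1 = 0 := by
  simp [binomialCentralMoment_succ R n 0, binomialCentralMoment_zero]

lemma binomialCentralMoment_two (n : ℕ) :
    binomialCentralMoment R n 2 = (n : R[X]) * ((X : R[X]) * (1 - X)) := by
  simp [binomialCentralMoment_succ R n 1, binomialCentralMoment_zero, binomialCentralMoment_one,
    mul_comm]

lemma binomialCentralMoment_three (n : ℕ) :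
    binomialCentralMoment R n 3 = (n : R[X]) * ((X : R[X]) * (1 - X) * (1 - 2 * X)) := by
  simp only [binomialCentralMoment_succ R n 2, binomialCentralMoment_two, derivative_mul,
    derivative_natCast, zero_mul, derivative_X, one_mul, derivative_sub, derivative_one, zero_sub,
    mul_neg, mul_one, zero_add, Nat.cast_mul, Nat.cast_ofNat, Nat.add_one_sub_one,
    binomialCentralMoment_one, mul_zero, add_zero]
  ring

lemma binomialCentralMoment_four (n : ℕ) :
    binomialCentralMoment R n 4 =
      3 * (n : R[X]) ^ 2 * (X * (1 - X)) ^ 2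
        + (n : R[X]) * (X * (1 - X) * (1 - 6 * (X * (1 - X)))) := by
  simp only [binomialCentralMoment_succ R n 3, binomialCentralMoment_three, derivative_mul,
    derivative_natCast, zero_mul, derivative_X, one_mul, derivative_sub, derivative_one, zero_sub,
    mul_neg, mul_one, derivative_ofNat, zero_add, Nat.cast_mul, Nat.cast_ofNat,
    Nat.add_one_sub_one, binomialCentralMoment_two]
  ring

end CentralMoment

section BinomialIntegral

open Polynomial

lemma integral_binomial_sub_mul_pow (n : ℕ) (p : unitInterval) (j : ℕ) :
    ∫ k, ((k : ℝ) - n * p) ^ j ∂binomial n p = (binomialCentralMoment ℝ n j).eval (p : ℝ) := by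
  rw [integral_binomial, binomialCentralMoment, eval_finsetSum, Nat.range_succ_eq_Iic]
  refine Finset.sum_congr rfl fun k _ => ?_
  simp [bernsteinPolynomial, mul_comm]

lemma integral_binomial_div_sub_pow {n : ℕ} (hn : n ≠ 0) (p : unitInterval) (j : ℕ) :
    ∫ k, ((k : ℝ) / n - p) ^ j ∂binomial n p
      = (binomialCentralMoment ℝ n j).eval (p : ℝ) / n ^ j := by
  have hn' : (n : ℝ) ≠ 0 := Nat.cast_ne_zero.2 hn
  rw [← integral_binomial_sub_mul_pow, ← integral_div]
  congr with k
  rw [← div_pow, sub_div, mul_div_cancel_left₀ _ hn']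

lemma integral_binomial_div_sub {n : ℕ} (hn : n ≠ 0) (p : unitInterval) :
    ∫ k, ((k : ℝ) / n - p) ∂binomial n p = 0 := by
  simpa [binomialCentralMoment_one] using integral_binomial_div_sub_pow hn p 1

lemma integral_binomial_div_sub_sq {n : ℕ} (hn : n ≠ 0) (p : unitInterval) :
    ∫ k, ((k : ℝ) / n - p) ^ 2 ∂binomial n p = p * (1 - p) / n := by
  rw [integral_binomial_div_sub_pow hn, binomialCentralMoment_two]
  simp only [eval_mul, eval_natCast, eval_X, eval_sub, eval_one]
  field_simp

lemma integral_binomial_div_sub_pow_four {n : ℕ} (hn : n ≠ 0) (p : unitInterval) :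
    ∫ k, ((k : ℝ) / n - p) ^ 4 ∂binomial n p
      = 3 * (p * (1 - p)) ^ 2 / n ^ 2 + p * (1 - p) * (1 - 6 * (p * (1 - p))) / n ^ 3 := by
  rw [integral_binomial_div_sub_pow hn, binomialCentralMoment_four]
  simp only [eval_add, eval_sub, eval_mul, eval_pow, eval_natCast, eval_ofNat, eval_one, eval_X]
  field_simp

end BinomialIntegral

section Length

lemma clopperPearsonUpper_eq_one_sub {n x : ℕ} (hx : x ≤ n) {α : ℝ} (hα : α ∈ Ioo (0 : ℝ) 1) :
    clopperPearsonUpper n α x = 1 - clopperPearsonLower n α (n - x) := by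
  rcases hx.eq_or_lt with rfl | hxn
  · simp [clopperPearsonUpper, clopperPearsonLower]
  · obtain ⟨hL, htail⟩ := clopperPearsonLower_spec n (n - x) (by omega) (by omega) α hα
    refine (existsUnique_binomialLowerTail_eq n x hxn (α / 2)
      ⟨by linarith [hα.1], by linarith [hα.2]⟩).unique (clopperPearsonUpper_spec n x hxn α hα)
      ⟨Icc.mem_iff_one_sub_mem.1 hL, ?_⟩
    rw [binomialLowerTail_one_sub hx, htail]

lemma clopperPearsonLower_mem_Icc {n x : ℕ} (hx : x ≤ n) {α : ℝ} (hα : α ∈ Ioo (0 : ℝ) 1) :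
    clopperPearsonLower n α x ∈ Icc (0 : ℝ) 1 := by
  rcases eq_or_ne x 0 with rfl | hx0
  · simp [clopperPearsonLower]
  · exact (clopperPearsonLower_spec n x hx0 hx α hα).1

lemma abs_clopperPearsonLength_le_one {n x : ℕ} (hx : x ≤ n) {α : ℝ} (hα : α ∈ Ioo (0 : ℝ) 1) :
    |clopperPearsonLength n α x| ≤ 1 := by
  obtain ⟨hl0, hl1⟩ := clopperPearsonLower_mem_Icc hx hα
  obtain ⟨hu0, hu1⟩ := clopperPearsonLower_mem_Icc (Nat.sub_le n x) hα
  rw [clopperPearsonLength, clopperPearsonUpper_eq_one_sub hx hα, abs_le]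
  constructor <;> linarith

lemma exists_abs_clopperPearsonLower_sub_le {a α : ℝ} (ha : 0 < a) (hα : α ∈ Ioo (0 : ℝ) 1) :
    ∃ C : ℝ, ∀ᶠ ε : ℝ in 𝓝[>] 0, ∀ n x : ℕ, ε ^ 2 * n = 1 → (x / n : ℝ) ∈ Icc a (1 - a) →
      |clopperPearsonLower n α x
        - betaQuantileApprox (x / n) ε (-stdNormalUpperQuantile (α / 2))| ≤ C * ε ^ 4 := by
  obtain ⟨C, hC⟩ := exists_abs_clopperPearsonLower_succ_sub_le ha hα
  refine ⟨C, hC.mono fun ε h n x hn hr => ?_⟩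
  obtain ⟨m, rfl⟩ : ∃ m, n = m + 1 := Nat.exists_eq_succ_of_ne_zero (by rintro rfl; simp at hn)
  obtain ⟨y, rfl⟩ : ∃ y, x = y + 1 := Nat.exists_eq_succ_of_ne_zero (by
    rintro rfl
    rw [Nat.cast_zero, zero_div] at hr
    exact ha.not_ge hr.1)
  exact h m y _ ⟨hr, by exact_mod_cast hn, by push_cast; field_simp⟩

/-- Coefficient of `n ^ (-3/2)` in the expansion of the length of the interval at sample
proportion `r`, where `z` is the normal quantile. -/
noncomputable def lengthCoeff (z r : ℝ) : ℝ :=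
  z / 18 * ((1 - 13 * (r * (1 - r))) * z ^ 2 + 2 - 17 * (r * (1 - r))) / bernoulliSD r

/-- Expansion of the length of the interval at sample proportion `r`, where `z` is the normal
quantile and `ε = n ^ (-1/2)`. -/
noncomputable def lengthApprox (z r ε : ℝ) : ℝ :=
  2 * z * ε * bernoulliSD r + ε ^ 2 + ε ^ 3 * lengthCoeff z r

lemma bernoulliSD_one_sub (r : ℝ) : bernoulliSD (1 - r) = bernoulliSD r := by
  rw [bernoulliSD, bernoulliSD, sub_sub_cancel, mul_comm]

lemma one_sub_betaQuantileApprox_sub_betaQuantileApprox (z r ε : ℝ) :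
    1 - betaQuantileApprox (1 - r) ε (-z) - betaQuantileApprox r ε (-z) = lengthApprox z r ε := by
  simp only [betaQuantileApprox, cornishFisher, bernoulliSD_one_sub, lengthApprox, lengthCoeff]
  ring

lemma exists_abs_clopperPearsonLength_sub_lengthApprox_le {a α : ℝ} (ha : 0 < a)
    (hα : α ∈ Ioo (0 : ℝ) 1) :
    ∃ C : ℝ, ∀ᶠ ε : ℝ in 𝓝[>] 0, ∀ n x : ℕ, ε ^ 2 * n = 1 → x ≤ n → (x / n : ℝ) ∈ Icc a (1 - a) →
      |clopperPearsonLength n α x - lengthApprox (stdNormalUpperQuantile (α / 2)) (x / n) ε|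
        ≤ C * ε ^ 4 := by
  obtain ⟨C, hC⟩ := exists_abs_clopperPearsonLower_sub_le ha hα
  refine ⟨2 * C, hC.mono fun ε h n x hn hx hr => ?_⟩
  have hn0 : (n : ℝ) ≠ 0 := right_ne_zero_of_mul_eq_one hn
  have hcompl : ((n - x : ℕ) : ℝ) / n = 1 - x / n := by
    rw [Nat.cast_sub hx, sub_div, div_self hn0]
  have hlower := h n x hn hr
  have hupper := h n (n - x) hn (by
    rw [hcompl]; exact ⟨by linarith [hr.2], by linarith [hr.1]⟩)
  rw [hcompl] at hupper
  rw [clopperPearsonLength, clopperPearsonUpper_eq_one_sub hx hα,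
    ← one_sub_betaQuantileApprox_sub_betaQuantileApprox]
  rw [abs_le] at hlower hupper ⊢
  constructor <;> linarith [hlower.1, hlower.2, hupper.1, hupper.2]

end Length

section Taylor

lemma bernoulliSD_add_sub_isBigO {p : ℝ} (hp : p ∈ Ioo (0 : ℝ) 1) :
    (fun d => bernoulliSD (p + d) - (bernoulliSD p + (1 - 2 * p) / (2 * bernoulliSD p) * d
      - (8 * bernoulliSD p ^ 3)⁻¹ * d ^ 2)) =O[𝓝 0] fun d => d ^ 3 := by
  have hσ := bernoulliSD_pos hp
  have hsq := bernoulliSD_sq (Ioo_subset_Icc_self hp)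
  set σ := bernoulliSD p
  set P : ℝ → ℝ := fun d => σ + (1 - 2 * p) / (2 * σ) * d - (8 * σ ^ 3)⁻¹ * d ^ 2 with hP
  -- `σ (p + d) - P d = (σ (p + d) ^ 2 - P d ^ 2) / (σ (p + d) + P d)`
  set Q : ℝ → ℝ := fun d => (1 - 2 * p) / σ * (8 * σ ^ 3)⁻¹ - (8 * σ ^ 3)⁻¹ ^ 2 * d with hQ
  have hnum (d : ℝ) : (p + d) * (1 - (p + d)) - P d ^ 2 = d ^ 3 * Q d := by
    simp only [hP, hQ]
    field_simp
    linear_combination -256 * σ ^ 4 * (σ ^ 2 + d ^ 2) * hsq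
  have hcont : ContinuousAt (fun d => bernoulliSD (p + d) + P d) 0 := by
    have := continuous_bernoulliSD
    fun_prop
  have hden0 : bernoulliSD (p + 0) + P 0 ≠ 0 := by
    have : P 0 = σ := by simp [hP]
    rw [add_zero, this]
    exact (add_pos hσ hσ).ne'
  have hbdd : (fun d => Q d / (bernoulliSD (p + d) + P d)) =O[𝓝 0] fun _ => (1 : ℝ) :=
    ((by fun_prop : ContinuousAt Q 0).div hcont hden0).isBigO_one ℝ
  have hmem : ∀ᶠ d in 𝓝 0, p + d ∈ Ioo (0 : ℝ) 1 :=
    (continuous_const_add p).continuousAt.eventually_mem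
      (Ioo_mem_nhds (by simpa using hp.1) (by simpa using hp.2))
  refine ((Asymptotics.isBigO_refl (fun d : ℝ => d ^ 3) _).mul hbdd).congr' ?_ (by simp)
  filter_upwards [hmem, hcont.eventually_ne hden0] with d hd hden
  rw [← mul_div_assoc, ← hnum, ← bernoulliSD_sq (Ioo_subset_Icc_self hd), div_eq_iff hden]
  ring

lemma lengthCoeff_add_sub_isBigO (z : ℝ) {p : ℝ} (hp : p ∈ Ioo (0 : ℝ) 1) :
    (fun d => lengthCoeff z (p + d) - lengthCoeff z p) =O[𝓝 0] fun d => d := by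
  have hσ := bernoulliSD_pos hp
  have hdiff : DifferentiableAt ℝ (lengthCoeff z) (p + 0) := by
    rw [add_zero]
    have : DifferentiableAt ℝ bernoulliSD p :=
      DifferentiableAt.sqrt (by fun_prop) (mul_pos hp.1 (sub_pos.2 hp.2)).ne'
    unfold lengthCoeff
    fun_prop (disch := exact hσ.ne')
  have hcomp : DifferentiableAt ℝ (fun d => lengthCoeff z (p + d)) 0 :=
    hdiff.comp 0 (by fun_prop)
  simpa using hcomp.isBigO_sub

/-- Taylor approximation of `lengthApprox z (p + d) ε` for small `d`. -/
noncomputable def lengthTaylor (z p ε d : ℝ) : ℝ :=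
  2 * z * ε * (bernoulliSD p + (1 - 2 * p) / (2 * bernoulliSD p) * d
    - (8 * bernoulliSD p ^ 3)⁻¹ * d ^ 2) + ε ^ 2 + ε ^ 3 * lengthCoeff z p

lemma abs_mul_abs_pow_three_le (x y : ℝ) : |x| * |y| ^ 3 ≤ x ^ 2 * y ^ 2 + y ^ 4 := by
  have hAMGM := two_mul_le_add_sq (|x| * |y|) (|y| ^ 2)
  have hpos : 0 ≤ |x| * |y| ^ 3 := by positivity
  have hpow : (|x| * |y|) ^ 2 + (|y| ^ 2) ^ 2 = x ^ 2 * y ^ 2 + y ^ 4 := by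
    rw [mul_pow, sq_abs, sq_abs, ← pow_mul]
  linarith

lemma exists_abs_lengthApprox_sub_lengthTaylor_le (z : ℝ) {p : ℝ} (hp : p ∈ Ioo (0 : ℝ) 1) :
    ∃ C, 0 ≤ C ∧ ∀ᶠ d in 𝓝 0, ∀ ε : ℝ, |lengthApprox z (p + d) ε - lengthTaylor z p ε d|
      ≤ C * (d ^ 4 + ε ^ 2 * d ^ 2 + ε ^ 4) := by
  obtain ⟨A, hA, hσ⟩ := (bernoulliSD_add_sub_isBigO hp).exists_nonneg
  obtain ⟨B, hB, hc⟩ := (lengthCoeff_add_sub_isBigO z hp).exists_nonneg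
  refine ⟨2 * |z| * A + B, by positivity, ?_⟩
  filter_upwards [hσ.bound, hc.bound] with d hσ hc ε
  simp only [Real.norm_eq_abs, abs_pow] at hσ hc
  have hd3 := abs_mul_abs_pow_three_le ε d
  have hd1 := abs_mul_abs_pow_three_le d ε
  have hd4 : 0 ≤ d ^ 4 := by positivity
  have hε4 : 0 ≤ ε ^ 4 := by positivity
  calc |lengthApprox z (p + d) ε - lengthTaylor z p ε d|
      = |2 * z * ε * (bernoulliSD (p + d) - (bernoulliSD p
          + (1 - 2 * p) / (2 * bernoulliSD p) * d - (8 * bernoulliSD p ^ 3)⁻¹ * d ^ 2))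
        + ε ^ 3 * (lengthCoeff z (p + d) - lengthCoeff z p)| := by
        rw [lengthApprox, lengthTaylor]; ring_nf
    _ ≤ 2 * |z| * |ε| * (A * |d| ^ 3) + |ε| ^ 3 * (B * |d|) := by
        refine (abs_add_le _ _).trans ?_
        simp only [abs_mul, abs_pow, abs_two]
        gcongr
    _ = 2 * |z| * A * (|ε| * |d| ^ 3) + B * (|d| * |ε| ^ 3) := by ring
    _ ≤ (2 * |z| * A + B) * (d ^ 4 + ε ^ 2 * d ^ 2 + ε ^ 4) := by
        rw [add_mul]
        gcongr
        · linarith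
        · linarith

lemma exists_abs_lengthTaylor_le (z p : ℝ) :
    ∃ B, ∀ ε ∈ Icc (0 : ℝ) 1, ∀ d ∈ Icc (-1 : ℝ) 1, |lengthTaylor z p ε d| ≤ B := by
  have hcont : Continuous fun x : ℝ × ℝ => lengthTaylor z p x.1 x.2 := by
    unfold lengthTaylor
    fun_prop
  obtain ⟨B, hB⟩ := (isCompact_Icc.prod isCompact_Icc).exists_bound_of_continuousOn
    (s := Icc (0 : ℝ) 1 ×ˢ Icc (-1 : ℝ) 1) hcont.continuousOn
  exact ⟨B, fun ε hε d hd => hB (ε, d) ⟨hε, hd⟩⟩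

lemma exists_abs_clopperPearsonLength_sub_lengthTaylor_le_of_lt {α p : ℝ}
    (hα : α ∈ Ioo (0 : ℝ) 1) (hp : p ∈ Ioo (0 : ℝ) 1) :
    ∃ C, 0 ≤ C ∧ ∃ δ > 0, ∀ᶠ ε : ℝ in 𝓝[>] 0, ∀ n x : ℕ, ε ^ 2 * n = 1 → x ≤ n →
      |(x : ℝ) / n - p| < δ →
      |clopperPearsonLength n α x
        - lengthTaylor (stdNormalUpperQuantile (α / 2)) p ε (x / n - p)|
        ≤ C * (((x : ℝ) / n - p) ^ 4 + ε ^ 2 * ((x : ℝ) / n - p) ^ 2 + ε ^ 4) := by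
  set z := stdNormalUpperQuantile (α / 2)
  obtain ⟨a, ha, hap⟩ := exists_between (lt_min hp.1 (sub_pos.2 hp.2))
  obtain ⟨hap, hap'⟩ := lt_min_iff.1 hap
  obtain ⟨A, hA⟩ := exists_abs_clopperPearsonLength_sub_lengthApprox_le ha hα
  obtain ⟨T, hT0, hT⟩ := exists_abs_lengthApprox_sub_lengthTaylor_le z hp
  have hmem : ∀ᶠ d in 𝓝 0, p + d ∈ Icc a (1 - a) :=
    (continuous_const_add p).continuousAt.eventually_mem
      (Icc_mem_nhds (by simpa using hap) (by rw [add_zero]; linarith))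
  obtain ⟨δ, hδ, hnear⟩ := Metric.eventually_nhds_iff.1 (hT.and hmem)
  refine ⟨|A| + T, by positivity, δ, hδ, hA.mono fun ε hA n x hn hx hdδ => ?_⟩
  obtain ⟨d, hd⟩ : ∃ d, (x : ℝ) / n - p = d := ⟨_, rfl⟩
  have hr : (x : ℝ) / n = p + d := by linarith
  rw [hd] at hdδ ⊢
  obtain ⟨hTd, hrd⟩ := hnear (y := d) (by simpa using hdδ)
  have hAn := hA n x hn hx (hr ▸ hrd)
  rw [hr] at hAn
  have hA' : A * ε ^ 4 ≤ |A| * (d ^ 4 + ε ^ 2 * d ^ 2 + ε ^ 4) := by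
    gcongr
    · exact le_abs_self A
    · exact le_add_of_nonneg_left (by positivity)
  rw [add_mul]
  exact (abs_sub_le _ (lengthApprox z (p + d) ε) _).trans (add_le_add (hAn.trans hA') (hTd ε))

lemma exists_abs_clopperPearsonLength_sub_lengthTaylor_le_of_le {α p δ : ℝ}
    (hα : α ∈ Ioo (0 : ℝ) 1) (hp : p ∈ Icc (0 : ℝ) 1) (z : ℝ) (hδ : 0 < δ) :
    ∃ C, 0 ≤ C ∧ ∀ ε ∈ Icc (0 : ℝ) 1, ∀ n x : ℕ, x ≤ n → δ ≤ |(x : ℝ) / n - p| →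
      |clopperPearsonLength n α x - lengthTaylor z p ε (x / n - p)|
        ≤ C * ((x : ℝ) / n - p) ^ 4 := by
  obtain ⟨B, hB⟩ := exists_abs_lengthTaylor_le z p
  refine ⟨(1 + |B|) / δ ^ 4, by positivity, fun ε hε n x hx hδd => ?_⟩
  have hr1 : (x : ℝ) / n ≤ 1 := div_le_one_of_le₀ (Nat.cast_le.2 hx) n.cast_nonneg
  have hr0 : 0 ≤ (x : ℝ) / n := by positivity
  have hBd := hB ε hε (x / n - p) ⟨by linarith [hp.2], by linarith [hp.1]⟩
  calc _ ≤ |clopperPearsonLength n α x| + |lengthTaylor z p ε (x / n - p)| := abs_sub _ _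
    _ ≤ 1 + |B| := add_le_add (abs_clopperPearsonLength_le_one hx hα) (hBd.trans (le_abs_self B))
    _ ≤ (1 + |B|) / δ ^ 4 * ((x : ℝ) / n - p) ^ 4 := by
      rw [div_mul_eq_mul_div, le_div_iff₀ (by positivity),
        ← Even.pow_abs (by decide : Even 4) ((x : ℝ) / n - p)]
      gcongr

lemma exists_abs_clopperPearsonLength_sub_lengthTaylor_le {α p : ℝ} (hα : α ∈ Ioo (0 : ℝ) 1)
    (hp : p ∈ Ioo (0 : ℝ) 1) :
    ∃ C, 0 ≤ C ∧ ∀ᶠ ε : ℝ in 𝓝[>] 0, ∀ n x : ℕ, ε ^ 2 * n = 1 → x ≤ n →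
      |clopperPearsonLength n α x
        - lengthTaylor (stdNormalUpperQuantile (α / 2)) p ε (x / n - p)|
        ≤ C * (((x : ℝ) / n - p) ^ 4 + ε ^ 2 * ((x : ℝ) / n - p) ^ 2 + ε ^ 4) := by
  obtain ⟨A, hA, δ, hδ, hnear⟩ := exists_abs_clopperPearsonLength_sub_lengthTaylor_le_of_lt hα hp
  obtain ⟨B, hB, hfar⟩ := exists_abs_clopperPearsonLength_sub_lengthTaylor_le_of_le hα
    (Ioo_subset_Icc_self hp) (stdNormalUpperQuantile (α / 2)) hδ
  refine ⟨A + B, add_nonneg hA hB, ?_⟩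
  filter_upwards [hnear, eventually_mem_Ioo_nhdsGT_zero] with ε hnear hε n x hn hx
  rcases lt_or_ge |(x : ℝ) / n - p| δ with hd | hd
  · refine (hnear n x hn hx hd).trans ?_
    gcongr
    exact le_add_of_nonneg_right hB
  · refine (hfar ε (Ioo_subset_Icc_self hε) n x hx hd).trans ?_
    gcongr
    · exact le_add_of_nonneg_left hA
    · rw [add_assoc]
      exact le_add_of_nonneg_right (by positivity)

end Taylor

section Expectation

lemma integral_lengthTaylor {n : ℕ} {ε : ℝ} (hn : ε ^ 2 * n = 1) (z : ℝ) {p : unitInterval}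
    (hp : (p : ℝ) ∈ Ioo (0 : ℝ) 1) :
    ∫ k, lengthTaylor z p ε ((k : ℝ) / n - p) ∂binomial n p
      = 2 * z * ε * bernoulliSD p + ε ^ 2 + ε ^ 3 * (bernoulliSD p)⁻¹ * (z / 18)
        * (z ^ 2 - 5 / 2 - 17 * (p * (1 - p)) - 13 * (p * (1 - p)) * z ^ 2) := by
  have hn0 : n ≠ 0 := by rintro rfl; simp at hn
  have hσ := bernoulliSD_pos hp
  have hinv : (n : ℝ)⁻¹ = ε ^ 2 := (eq_inv_of_mul_eq_one_left hn).symm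
  have hsq := bernoulliSD_sq (Ioo_subset_Icc_self hp)
  simp only [lengthTaylor]
  rw [integral_add (integrable_binomial _) (integrable_binomial _),
    integral_add (integrable_binomial _) (integrable_binomial _), integral_const_mul,
    integral_sub (integrable_binomial _) (integrable_binomial _),
    integral_add (integrable_binomial _) (integrable_binomial _), integral_const_mul,
    integral_const_mul, integral_binomial_div_sub hn0, integral_binomial_div_sub_sq hn0,
    div_eq_mul_inv _ (n : ℝ), hinv, ← hsq]
  simp only [integral_const, probReal_univ, one_smul, lengthCoeff, ← hsq]
  field_simp
  ring

lemma integral_taylorError_le {n : ℕ} {ε : ℝ} (hn : ε ^ 2 * n = 1) (p : unitInterval) :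
    ∫ k, (((k : ℝ) / n - p) ^ 4 + ε ^ 2 * ((k : ℝ) / n - p) ^ 2 + ε ^ 4) ∂binomial n p
      ≤ 6 * ε ^ 4 := by
  have hn0 : n ≠ 0 := by rintro rfl; simp at hn
  have hinv : (n : ℝ)⁻¹ = ε ^ 2 := (eq_inv_of_mul_eq_one_left hn).symm
  rw [integral_add (integrable_binomial _) (integrable_binomial _),
    integral_add (integrable_binomial _) (integrable_binomial _), integral_const_mul,
    integral_binomial_div_sub_sq hn0, integral_binomial_div_sub_pow_four hn0, div_eq_mul_inv,
    div_eq_mul_inv, div_eq_mul_inv, ← inv_pow, ← inv_pow, hinv, integral_const, probReal_univ,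
    one_smul]
  have hv0 : 0 ≤ (p : ℝ) * (1 - p) := mul_nonneg p.2.1 (sub_nonneg.2 p.2.2)
  have hv1 : (p : ℝ) * (1 - p) ≤ 1 := mul_le_one₀ p.2.2 (sub_nonneg.2 p.2.2) (by linarith [p.2.1])
  generalize (p : ℝ) * (1 - p) = v at *
  have hε1 : ε ^ 2 ≤ 1 := by
    rw [← hinv]
    exact inv_le_one_of_one_le₀ (Nat.one_le_cast.2 (Nat.one_le_iff_ne_zero.2 hn0))
  have hv6 : v * (1 - 6 * v) ≤ v := mul_le_of_le_one_right hv0 (by linarith)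
  have hvsq : v ^ 2 ≤ 1 := pow_le_one₀ hv0 hv1
  calc _ = (3 * v ^ 2 + v + 1) * ε ^ 4 + v * (1 - 6 * v) * ε ^ 4 * ε ^ 2 := by ring
    _ ≤ (3 * 1 + 1 + 1) * ε ^ 4 + 1 * ε ^ 4 * 1 := by
        gcongr
        exact hv6.trans hv1
    _ = 6 * ε ^ 4 := by ring

lemma exists_abs_expectedClopperPearsonLength_sub_le {α : ℝ} (hα : α ∈ Ioo (0 : ℝ) 1)
    {p : unitInterval} (hp : (p : ℝ) ∈ Ioo (0 : ℝ) 1) :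
    ∃ C : ℝ, ∀ᶠ ε : ℝ in 𝓝[>] 0, ∀ n : ℕ, ε ^ 2 * n = 1 →
      |expectedClopperPearsonLength n α p
        - ∫ k, lengthTaylor (stdNormalUpperQuantile (α / 2)) p ε ((k : ℝ) / n - p) ∂binomial n p|
        ≤ C * ε ^ 4 := by
  obtain ⟨C, hC0, hC⟩ := exists_abs_clopperPearsonLength_sub_lengthTaylor_le hα hp
  refine ⟨C * 6, hC.mono fun ε h n hn => ?_⟩
  rw [expectedClopperPearsonLength, ← integral_sub (integrable_binomial _) (integrable_binomial _),
    mul_assoc]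
  set z := stdNormalUpperQuantile (α / 2)
  have hbound : ∀ᵐ k : ℕ ∂binomial n p,
      ‖clopperPearsonLength n α k - lengthTaylor z p ε ((k : ℝ) / n - p)‖
        ≤ C * (((k : ℝ) / n - p) ^ 4 + ε ^ 2 * ((k : ℝ) / n - p) ^ 2 + ε ^ 4) := by
    filter_upwards [ae_le_of_hasLaw_binomial HasLaw.id] with k hk
    exact h n k hn hk
  refine (norm_integral_le_of_norm_le (integrable_binomial _) hbound).trans ?_
  rw [integral_const_mul]
  gcongr
  exact integral_taylorError_le hn p

end Expectation

lemma tendsto_inv_sqrt_natCast_nhdsGT_zero :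
    Tendsto (fun n : ℕ => (√(n : ℝ))⁻¹) atTop (𝓝[>] 0) :=
  tendsto_inv_atTop_nhdsGT_zero.comp
    (Real.tendsto_sqrt_atTop.comp tendsto_natCast_atTop_atTop)

lemma rpow_neg_div_two_eq {x : ℝ} (hx : 0 ≤ x) (k : ℕ) : x ^ (-(k / 2) : ℝ) = (√x)⁻¹ ^ k := by
  rw [Real.rpow_neg hx, inv_pow, Real.sqrt_eq_rpow, ← Real.rpow_mul_natCast hx, one_div_mul_eq_div]

theorem theorem2 (α p : ℝ) (hα : α ∈ Set.Ioo (0 : ℝ) 1) (hp : p ∈ Set.Ioo (0 : ℝ) 1)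
    (q z : ℝ) (hq : q = 1 - p) (hz : z = stdNormalUpperQuantile (α / 2)) :
    (fun n : ℕ =>
      expectedClopperPearsonLength n α ⟨p, Set.Ioo_subset_Icc_self hp⟩
        - (2 * z * (n : ℝ) ^ (-(1 / 2) : ℝ) * (p * q) ^ (1 / 2 : ℝ)
            + (n : ℝ) ^ (-1 : ℝ)
            + (n : ℝ) ^ (-(3 / 2) : ℝ) * (p * q) ^ (-(1 / 2) : ℝ) * (z / 18)
                * (z ^ 2 - 5 / 2 - 17 * (p * q) - 13 * (p * q) * z ^ 2)))
      =O[Filter.atTop] (fun n : ℕ => (n : ℝ) ^ (-2 : ℝ)) := by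
  subst hq hz
  obtain ⟨C, hC⟩ := exists_abs_expectedClopperPearsonLength_sub_le hα
    (p := ⟨p, Ioo_subset_Icc_self hp⟩) hp
  refine Asymptotics.IsBigO.of_bound C ?_
  filter_upwards [tendsto_inv_sqrt_natCast_nhdsGT_zero.eventually hC, eventually_gt_atTop 0]
    with n h hn
  have hε : (√(n : ℝ))⁻¹ ^ 2 * n = 1 := by
    rw [inv_pow, Real.sq_sqrt n.cast_nonneg, inv_mul_cancel₀ (by positivity)]
  have hv : 0 ≤ p * (1 - p) := mul_nonneg hp.1.le (sub_nonneg.2 hp.2.le)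
  have hpow := rpow_neg_div_two_eq (n.cast_nonneg (α := ℝ))
  have hpow1 : (n : ℝ) ^ (-(1 / 2) : ℝ) = (√n)⁻¹ := by simpa using hpow 1
  have hpow2 : (n : ℝ) ^ (-1 : ℝ) = (√n)⁻¹ ^ 2 := by simpa using hpow 2
  have hpow3 : (n : ℝ) ^ (-(3 / 2) : ℝ) = (√n)⁻¹ ^ 3 := by simpa using hpow 3
  have hpow4 : (n : ℝ) ^ (-2 : ℝ) = (√n)⁻¹ ^ 4 := by convert hpow 4; norm_num
  have hσ : (p * (1 - p)) ^ (1 / 2 : ℝ) = bernoulliSD p := (Real.sqrt_eq_rpow _).symm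
  have hσ' : (p * (1 - p)) ^ (-(1 / 2) : ℝ) = (bernoulliSD p)⁻¹ := by rw [Real.rpow_neg hv, hσ]
  have hmain := h n hε
  rw [integral_lengthTaylor hε _ hp] at hmain
  rw [hpow1, hpow2, hpow3, hpow4, hσ, hσ', Real.norm_eq_abs, Real.norm_of_nonneg (by positivity)]
  exact hmain
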